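/- **Theorem 4.5.** Graphs are finite multigraphs (loops and parallel edges allowed), taken up to isomorphism. $\operatorname{Aut} G$ is the full automorphism group, acting on vertices and half-edges: it includes permutations of parallel edges and permutations and flips of loops. Let $\Gamma(g)$ be the set of connected graphs with first Betti number $g$, and let $\Gamma_{\ge 3}(g)\subset\Gamma(g)$ be the set of those all of whose vertices have degree at least $3$ (a loop contributes $2$ to the degree). A coloring $c$ of $G$ makes each vertex black or white. Let $B(c)$ be the set of black vertices, and let $W_+(c)$ (resp. $W_-(c)$) be the set of white vertices with an even (resp. odd) number of black neighbors, where neighbors are counted with the multiplicity of the joining edges and loops are ignored. Put $$W_G(t)=\sum_{c} t^{|W_+(c)|},\qquad \widetilde W_G(b,w_-,w_+)=\sum_{c} b^{|B(c)|}\,w_+^{|W_+(c)|}\,w_-^{|W_-(c)|},\qquad \mathscr W_g(x)=\sum_{G\in\Gamma(g)}\frac{W_G(t)\,x^{v(G)}}{|\operatorname{Aut}G|}\in\mathbb Q[t][[x]],$$ where $v(G)$ is the number of vertices. Let $\mathscr T_b,\mathscr T_w^+,\mathscr T_w^-\in\mathbb Q[t][[x]]$ be the series $$\sum_{T}\frac{x^{v(T)}}{|\operatorname{Aut}T|}\sum_{c}t^{|W_+(c)|},$$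 where $T$ runs over the rooted trees up to isomorphism, $\operatorname{Aut} T$ consists of the root-preserving automorphisms, and $c$ runs over the colorings of $T$ whose root lies in $B(c)$, $W_+(c)$, $W_-(c)$ respectively. For a graph $G$ with edge set $E$ and $k\colon E\to\mathbb Z_{\ge0}$, let $S_k(G)$ be the graph obtained by inserting $k(e)$ new vertices into each edge $e$. Put $$\mathscr Z_G=\frac1{|\operatorname{Aut}G|}\sum_{k\colon E\to\mathbb Z_{\ge0}}\widetilde W_{S_k(G)}(b,w_-,w_+)\in\mathbb Q[[b,w_-,w_+]].$$ Let $g\ge2$. Then $\Gamma_{\ge3}(g)$ is finite. For each $G\in\Gamma_{\ge3}(g)$, let $\mathscr X_G(x)$ be the result of the substitutions $$b\leftarrow\mathscr T_b,\qquad w_+\leftarrow\mathscr T_w^++\mathscr T_w^-,\qquad w_-\leftarrow t^{-1}\mathscr T_w^++t\,\mathscr T_w^-$$ in $\mathscr Z_G$. Then $\mathscr X_G(x)\in\mathbb Q[t][[x]]$, and $$\mathscr W_g(x)=\sum_{G\in\Gamma_{\ge3}(g)}\mathscr X_G(x).$$ -/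

import Mathlib

namespace BlackWhite

/-- A multigraph (loops and parallel edges allowed) with vertex set `V` and edge set `E`.
Each edge `e` consists of two half-edges `(e, false)` and `(e, true)`, attached to the vertices
`ends e false` and `ends e true`. The order of the two half-edges is only a matter of
presentation: isomorphisms are allowed to exchange them. -/
structure Multigraph (V E : Type*) where
  ends : E → Bool → V

/-- The other half of the edge containing a half-edge. -/
def flipHalf {E : Type*} (h : E × Bool) : E × Bool := (h.1, !h.2)

/-- The three kinds of vertices in a coloured graph, which also index the variables
`b`, `w₊`, `w₋`. -/
inductive VertexKind
  | black
  | whiteEven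
  | whiteOdd
  deriving DecidableEq

instance : Fintype VertexKind := ⟨{.black, .whiteEven, .whiteOdd}, by intro κ; cases κ <;> simp⟩

namespace Multigraph

variable {V E V' E' V'' E'' : Type*}

/-- The vertex to which a half-edge is attached. -/
def attach (G : Multigraph V E) (h : E × Bool) : V := G.ends h.1 h.2

/-- Isomorphisms of multigraphs: bijections on vertices and on half-edges which respect the
pairing of half-edges into edges and the attaching maps. In particular parallel edges may be
permuted, and loops may be permuted and flipped. -/
structure Iso (G : Multigraph V E) (G' : Multigraph V' E') where
  vert : V ≃ V'
  half : E × Bool ≃ E' × Bool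
  half_flip : ∀ h, half (flipHalf h) = flipHalf (half h)
  attach_half : ∀ h, G'.attach (half h) = vert (G.attach h)

/-- The identity isomorphism. -/
def Iso.refl (G : Multigraph V E) : Iso G G where
  vert := Equiv.refl V
  half := Equiv.refl _
  half_flip _ := rfl
  attach_half _ := rfl

/-- The inverse isomorphism. -/
def Iso.symm {G : Multigraph V E} {G' : Multigraph V' E'} (φ : Iso G G') : Iso G' G where
  vert := φ.vert.symm
  half := φ.half.symm
  half_flip h := by
    rw [Equiv.symm_apply_eq, φ.half_flip, Equiv.apply_symm_apply]
  attach_half h := by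
    rw [Equiv.eq_symm_apply, ← φ.attach_half, Equiv.apply_symm_apply]

/-- Composition of isomorphisms. -/
def Iso.trans {G : Multigraph V E} {G' : Multigraph V' E'} {G'' : Multigraph V'' E''}
    (φ : Iso G G') (ψ : Iso G' G'') : Iso G G'' where
  vert := φ.vert.trans ψ.vert
  half := φ.half.trans ψ.half
  half_flip h := by simp [φ.half_flip, ψ.half_flip]
  attach_half h := by simp [φ.attach_half, ψ.attach_half]

/-- The order of the full automorphism group of a multigraph. -/
noncomputable def autCard (G : Multigraph V E) : ℕ := Nat.card (Iso G G)

/-- The number of automorphisms fixing the vertex `r`. -/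
noncomputable def rootedAutCard (G : Multigraph V E) (r : V) : ℕ :=
  Nat.card {φ : Iso G G // φ.vert r = r}

/-- The underlying simple graph: distinct vertices are adjacent if some edge joins them. -/
def toSimpleGraph (G : Multigraph V E) : SimpleGraph V :=
  SimpleGraph.fromRel fun u v => ∃ e, G.ends e false = u ∧ G.ends e true = v

/-- A multigraph is connected if it is nonempty and any two vertices are joined by a walk. -/
def Connected (G : Multigraph V E) : Prop := G.toSimpleGraph.Connected

/-- The boundary map from 1-chains to 0-chains. -/
noncomputable def boundary (G : Multigraph V E) : (E →₀ ℤ) →ₗ[ℤ] (V →₀ ℤ) :=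
  Finsupp.linearCombination ℤ fun e =>
    Finsupp.single (G.ends e true) (1 : ℤ) - Finsupp.single (G.ends e false) (1 : ℤ)

/-- The loop number: the first Betti number, i.e. the rank of `H₁(G; ℤ)`. Since a graph has no
2-cells, `H₁(G; ℤ)` is the kernel of the boundary map. -/
noncomputable def loopNumber (G : Multigraph V E) : ℕ :=
  Module.finrank ℤ (LinearMap.ker G.boundary)

/-- The degree of a vertex: the number of half-edges attached to it (a loop counts twice). -/
noncomputable def degree (G : Multigraph V E) (v : V) : ℕ :=
  Nat.card {h : E × Bool // G.attach h = v}

/-- The number of black neighbours of `v` in the colouring `c` (white is `0`, black is `1`),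
where each neighbour is counted with the multiplicity of the edges joining it to `v`.
Loops at a white vertex `v` contribute nothing. It is only used when `v` is white. -/
noncomputable def blackNeighbors (G : Multigraph V E) (c : V → ZMod 2) (v : V) : ℕ :=
  Nat.card {h : E × Bool // G.attach h = v ∧ c (G.attach (flipHalf h)) = 1}

open Classical in
/-- The kind of a vertex in a coloured graph: black, white with an even number of black
neighbours, or white with an odd number of black neighbours. -/
noncomputable def kind (G : Multigraph V E) (c : V → ZMod 2) (v : V) : VertexKind :=
  if c v = 1 then .black else if Even (G.blackNeighbors c v) then .whiteEven else .whiteOdd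

/-- The monomial of a coloured graph in `ℤ[t]`: one factor `t` for each white vertex with an even
number of black neighbours. -/
noncomputable def coloringMonomial [Fintype V] (G : Multigraph V E) (c : V → ZMod 2) :
    Polynomial ℤ :=
  ∏ v, if G.kind c v = .whiteEven then Polynomial.X else 1

open Classical in
/-- The black-white polynomial `W_G(t)`. -/
noncomputable def W [Fintype V] (G : Multigraph V E) : Polynomial ℤ :=
  ∑ c : V → ZMod 2, G.coloringMonomial c

open Classical in
/-- The full `W`-polynomial, in the variables `b`, `w₊`, `w₋`. -/
noncomputable def fullW [Fintype V] (G : Multigraph V E) : MvPolynomial VertexKind ℤ :=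
  ∑ c : V → ZMod 2, ∏ v, MvPolynomial.X (G.kind c v)

/-- The subdivision of `G` in which, for each edge `e`, `k e` new vertices are inserted into `e`,
so that `e` is replaced by a path with `k e + 1` edges. -/
def subdivide (G : Multigraph V E) (k : E → ℕ) :
    Multigraph (V ⊕ (Σ e, Fin (k e))) (Σ e, Fin (k e + 1)) where
  ends
    | ⟨e, i⟩, false =>
        Fin.cases (Sum.inl (G.ends e false)) (fun j : Fin (k e) => Sum.inr ⟨e, j⟩) i
    | ⟨e, i⟩, true =>
        Fin.lastCases (Sum.inl (G.ends e true)) (fun j : Fin (k e) => Sum.inr ⟨e, j⟩) i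

/-- The series `𝒵_G = |Aut G|⁻¹ ∑_k W̃_{S_k(G)}(b, w₋, w₊)`, the sum being over all ways `k` of
subdividing the edges of `G`. It is given by its coefficients. -/
noncomputable def subdivisionSeries [Fintype V] [Fintype E] (G : Multigraph V E) :
    MvPowerSeries VertexKind ℚ := fun d =>
  (G.autCard : ℚ)⁻¹ * ∑ᶠ k : E → ℕ, (((G.subdivide k).fullW.coeff d : ℤ) : ℚ)

/-- The full `W`-polynomial is homogeneous, of degree the number of vertices. -/
theorem fullW_isHomogeneous [Fintype V] (G : Multigraph V E) :
    G.fullW.IsHomogeneous (Fintype.card V) := by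
  classical
  unfold fullW
  refine MvPolynomial.IsHomogeneous.sum _ _ _ fun c _ => ?_
  have := MvPolynomial.IsHomogeneous.prod (Finset.univ : Finset V)
    (fun v => (MvPolynomial.X (G.kind c v) : MvPolynomial VertexKind ℤ)) (fun _ => 1)
    (fun v _ => MvPolynomial.isHomogeneous_X _ _)
  simpa using this

/-- The sum defining each coefficient of `subdivisionSeries` is finite. -/
theorem subdivisionSeries_support_finite [Fintype V] [Fintype E] (G : Multigraph V E)
    (d : VertexKind →₀ ℕ) :
    (Function.support fun k : E → ℕ =>
      (((G.subdivide k).fullW.coeff d : ℤ) : ℚ)).Finite := by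
  classical
  refine (Set.finite_Iic (fun _ : E => d.degree)).subset fun k hk => ?_
  have h0 : (G.subdivide k).fullW.coeff d ≠ 0 := by
    intro h
    simp [h] at hk
  have h1 := (G.subdivide k).fullW_isHomogeneous
  have h2 : d.degree = Fintype.card V + ∑ e, k e := by
    by_contra hne
    apply h0
    apply h1.coeff_eq_zero
    simpa using hne
  intro e
  have : k e ≤ ∑ e, k e := Finset.single_le_sum (fun _ _ => Nat.zero_le _) (Finset.mem_univ e)
  show k e ≤ d.degree
  omega

/-- A graph with `n` vertices and loop number `g` has at most `g + n` edges. -/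
theorem card_edges_le [Fintype V] [Fintype E] (G : Multigraph V E) :
    Fintype.card E ≤ G.loopNumber + Fintype.card V := by
  have h := (LinearMap.ker G.boundary).finrank_quotient_add_finrank
  rw [G.boundary.quotKerEquivRange.finrank_eq] at h
  have h2 := Submodule.finrank_le (LinearMap.range G.boundary)
  simp only [Module.finrank_finsupp_self] at h h2
  unfold loopNumber
  omega

end Multigraph

/-- A finite multigraph, with vertex set `Fin order` and edge set `Fin size`. Every finite
multigraph is isomorphic to one of these. -/
structure FinMultigraph where
  order : ℕ
  size : ℕ
  graph : Multigraph (Fin order) (Fin size)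

/-- Finite multigraphs up to isomorphism. -/
instance FinMultigraph.setoid : Setoid FinMultigraph where
  r G H := Nonempty (Multigraph.Iso G.graph H.graph)
  iseqv :=
    { refl := fun G => ⟨Multigraph.Iso.refl G.graph⟩
      symm := fun ⟨φ⟩ => ⟨φ.symm⟩
      trans := fun ⟨φ⟩ ⟨ψ⟩ => ⟨φ.trans ψ⟩ }

/-- Isomorphism classes of finite multigraphs. -/
def MultigraphClass : Type := Quotient FinMultigraph.setoid

/-- A representative of an isomorphism class. All quantities evaluated on it below are invariant
under isomorphism. -/
noncomputable def MultigraphClass.rep (q : MultigraphClass) : FinMultigraph := Quotient.out q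

/-- `Γ(g)`: connected graphs with loop number `g`, up to isomorphism. -/
def Gamma (g : ℕ) : Set MultigraphClass :=
  {q | q.rep.graph.Connected ∧ q.rep.graph.loopNumber = g}

/-- `Γ_{≥3}(g)`: the graphs in `Γ(g)` all of whose vertices have degree at least `3`. -/
def GammaGeThree (g : ℕ) : Set MultigraphClass :=
  {q | q ∈ Gamma g ∧ ∀ v, 3 ≤ q.rep.graph.degree v}

/-- There are finitely many graphs in `Γ(g)` with a given number of vertices. -/
theorem gamma_order_finite (g n : ℕ) : {q | q ∈ Gamma g ∧ q.rep.order = n}.Finite := by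
  let F : (Σ m : Fin (g + n + 1), (Fin m → Bool → Fin n)) → MultigraphClass := fun p =>
    Quotient.mk FinMultigraph.setoid ⟨n, p.1, ⟨p.2⟩⟩
  refine (Set.finite_range F).subset ?_
  rintro q ⟨⟨-, hg⟩, hn⟩
  have hq : Quotient.mk FinMultigraph.setoid q.rep = q := Quotient.out_eq q
  generalize q.rep = H at hg hn hq
  obtain ⟨a, m, ⟨f⟩⟩ := H
  dsimp only at hn hg
  subst hn
  have := Multigraph.card_edges_le (⟨f⟩ : Multigraph (Fin a) (Fin m))
  rw [hg] at this
  simp only [Fintype.card_fin] at this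
  exact ⟨⟨⟨m, by omega⟩, f⟩, hq⟩

/-- The series `𝒲_g(x) = ∑_{G ∈ Γ(g)} W_G(t) x^{v(G)} / |Aut G|` in `ℚ[t]⟦x⟧`. -/
noncomputable def wrightSeries (g : ℕ) : PowerSeries (Polynomial ℚ) :=
  PowerSeries.mk fun n => ∑ᶠ q ∈ {q | q ∈ Gamma g ∧ q.rep.order = n},
    (q.rep.graph.autCard : ℚ)⁻¹ • q.rep.graph.W.map (Int.castRingHom ℚ)

/-- A finite rooted tree: a connected graph with loop number `0`, with a chosen vertex. -/
structure RootedTree where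
  order : ℕ
  size : ℕ
  graph : Multigraph (Fin order) (Fin size)
  root : Fin order
  connected : graph.Connected
  loopNumber_eq : graph.loopNumber = 0

/-- Rooted trees up to root-preserving isomorphism. -/
instance RootedTree.setoid : Setoid RootedTree where
  r S T := ∃ φ : Multigraph.Iso S.graph T.graph, φ.vert S.root = T.root
  iseqv :=
    { refl := fun S => ⟨Multigraph.Iso.refl S.graph, rfl⟩
      symm := fun ⟨φ, h⟩ => ⟨φ.symm, by rw [← h]; exact φ.vert.symm_apply_apply _⟩
      trans := fun ⟨φ, h⟩ ⟨ψ, h'⟩ => ⟨φ.trans ψ, by rw [← h', ← h]; rfl⟩ }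

/-- Isomorphism classes of rooted trees. -/
def RootedTreeClass : Type := Quotient RootedTree.setoid

/-- A representative of an isomorphism class of rooted trees. -/
noncomputable def RootedTreeClass.rep (q : RootedTreeClass) : RootedTree := Quotient.out q

/-- There are finitely many rooted trees with a given number of vertices. -/
theorem rootedTree_order_finite (n : ℕ) : {q : RootedTreeClass | q.rep.order = n}.Finite := by
  let D := Σ m : Fin (n + 1), (Fin m → Bool → Fin n) × Fin n
  let F : {p : D // (⟨p.2.1⟩ : Multigraph (Fin n) (Fin p.1)).Connected ∧
      (⟨p.2.1⟩ : Multigraph (Fin n) (Fin p.1)).loopNumber = 0} → RootedTreeClass := fun p =>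
    Quotient.mk RootedTree.setoid ⟨n, p.1.1, ⟨p.1.2.1⟩, p.1.2.2, p.2.1, p.2.2⟩
  have : Finite D := inferInstanceAs (Finite (Σ m : Fin (n + 1), (Fin m → Bool → Fin n) × Fin n))
  refine (Set.finite_range F).subset ?_
  rintro q (hn : q.rep.order = n)
  have hq : Quotient.mk RootedTree.setoid q.rep = q := Quotient.out_eq q
  generalize q.rep = H at hn hq
  obtain ⟨a, m, ⟨f⟩, r, hc, hl⟩ := H
  dsimp only at hn
  subst hn
  have := Multigraph.card_edges_le (⟨f⟩ : Multigraph (Fin a) (Fin m))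
  rw [hl] at this
  simp only [Fintype.card_fin] at this
  exact ⟨⟨⟨⟨m, by omega⟩, f, r⟩, hc, hl⟩, hq⟩

/-- The rooted tree series in `ℚ[t]⟦x⟧`: the contribution to
`𝒯 = ∑_T W_T(t) x^{v(T)} / |Aut T|` of the colourings for which the root has kind `κ`.
Thus `black`, `whiteEven`, `whiteOdd` give `𝒯_b`, `𝒯_w⁺`, `𝒯_w⁻`. -/
noncomputable def treeSeries (κ : VertexKind) : PowerSeries (Polynomial ℚ) :=
  PowerSeries.mk fun n => ∑ᶠ q ∈ {q : RootedTreeClass | q.rep.order = n},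
    (q.rep.graph.rootedAutCard q.rep.root : ℚ)⁻¹ •
      (∑ c : Fin q.rep.order → ZMod 2,
        if q.rep.graph.kind c q.rep.root = κ then q.rep.graph.coloringMonomial c else 0).map
          (Int.castRingHom ℚ)

/-- The inclusion `ℚ[t]⟦x⟧ → ℚ[t, t⁻¹]⟦x⟧`. -/
noncomputable def toLaurentSeries :
    PowerSeries (Polynomial ℚ) →+* PowerSeries (LaurentPolynomial ℚ) :=
  PowerSeries.map (Polynomial.toLaurent : Polynomial ℚ →+* LaurentPolynomial ℚ)

/-- The series substituted for the variables:
`b ← 𝒯_b`, `w₊ ← 𝒯_w⁺ + 𝒯_w⁻`, `w₋ ← t⁻¹ 𝒯_w⁺ + t 𝒯_w⁻`. -/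
noncomputable def treeSubstitution : VertexKind → PowerSeries (LaurentPolynomial ℚ)
  | .black => toLaurentSeries (treeSeries .black)
  | .whiteEven =>
      toLaurentSeries (treeSeries .whiteEven) + toLaurentSeries (treeSeries .whiteOdd)
  | .whiteOdd =>
      PowerSeries.C (LaurentPolynomial.T (-1)) * toLaurentSeries (treeSeries .whiteEven) +
        PowerSeries.C (LaurentPolynomial.T 1) * toLaurentSeries (treeSeries .whiteOdd)

/-- The tree series have no constant term. -/
theorem constantCoeff_treeSeries (κ : VertexKind) :
    PowerSeries.constantCoeff (treeSeries κ) = 0 := by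
  rw [← PowerSeries.coeff_zero_eq_constantCoeff_apply, treeSeries, PowerSeries.coeff_mk]
  refine finsum_mem_eq_zero_of_forall_eq_zero fun q hq => ?_
  have h := q.rep.root.isLt
  have hq' : q.rep.order = 0 := hq
  omega

/-- The substitution makes sense for arbitrary power series in `b`, `w₊`, `w₋`. -/
theorem hasSubst_treeSubstitution : MvPowerSeries.HasSubst treeSubstitution := by
  refine MvPowerSeries.hasSubst_of_constantCoeff_zero fun κ => ?_
  change PowerSeries.constantCoeff (treeSubstitution κ) = 0
  have h (κ : VertexKind) :
      PowerSeries.constantCoeff (toLaurentSeries (treeSeries κ)) = 0 := by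
    rw [← PowerSeries.coeff_zero_eq_constantCoeff_apply, toLaurentSeries, PowerSeries.coeff_map,
      PowerSeries.coeff_zero_eq_constantCoeff_apply, constantCoeff_treeSeries, map_zero]
  cases κ <;> simp [treeSubstitution, h]

/-- The result of substituting the tree series into `𝒵_G`, as a power series in `x` over
`ℚ[t, t⁻¹]`. -/
noncomputable def substitutedSeries {V E : Type*} [Fintype V] [Fintype E] (G : Multigraph V E) :
    PowerSeries (LaurentPolynomial ℚ) :=
  MvPowerSeries.subst treeSubstitution G.subdivisionSeries

end BlackWhite

namespace BlackWhite

/-! A connected graph `H` with Betti number `g ≥ 2` has a nonempty 2-core, and `H` is this core with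
a rooted tree attached at each core vertex (`exists_iso_assemble`). The core has minimal degree at
least 2, and smoothing its vertices of degree 2 shows it to be a subdivision of a graph with all
degrees at least 3 (`exists_iso_subdivide`). Thus every `H` arises from a triple: a graph `G` in
`GammaGeThree g`, subdivision lengths `k`, and a family `f` of rooted trees
(`exists_iso_attachTrees_subdivide`).

The polynomial follows this decomposition (`W_assemble`). Away from the core a vertex has the kind
that it has in its tree. At a core vertex the black neighbours in the core and in the tree add up.
If the core contributes an even number, the factor of the tree is unchanged, which gives `𝒯_w⁺ +
𝒯_w⁻`. If it contributes an odd number, the parity of the root is reversed: a root that was even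
loses its `t` and one that was odd gains a `t`, which gives `t⁻¹ 𝒯_w⁺ + t 𝒯_w⁻`. The factor `t⁻¹`
only cancels a `t` that is present, so the substituted series already exist over `ℚ[t]` as
`attachedSeries`.

The automorphism factors are handled by counting isomorphisms instead of orbits. For fixed `H`, the
sum over all triples of `1/|Aut G| · ∏ 1/|Aut (f v)| · |Iso(assembled graph, H)|` equals 1
(`sum_weight_card_iso`). To see this, fix one triple `(G₀, k₀, f₀)` producing `H`. Isomorphisms
preserve cores, so each one consists of an isomorphism of subdivisions and compatible rooted
isomorphisms of trees (`card_iso_assemble`). Summing over `f` turns the tree factors into 1. Degrees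
distinguish old vertices from inserted ones, so the isomorphisms of subdivisions, taken over all
`k`, correspond to isomorphisms `G ≅ G₀` (`sum_card_iso_subdivide`). Finally the sum of `|Iso(G,
G₀)|/|Aut G|` over classes is 1. Inserting this 1 into each term of `wrightSeries` and exchanging
sums gives the theorem (`wrightSeries_eq`). -/

theorem flipHalf_flipHalf {E : Type*} (h : E × Bool) : flipHalf (flipHalf h) = h := by
  simp [flipHalf]

theorem flipHalf_ne {E : Type*} (h : E × Bool) : flipHalf h ≠ h := by
  intro H
  have := congrArg Prod.snd H
  simp [flipHalf] at this

theorem eq_or_eq_flipHalf {E : Type*} {h h' : E × Bool} (H : h.1 = h'.1) :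
    h = h' ∨ h = flipHalf h' := by
  obtain ⟨e, b⟩ := h
  obtain ⟨e', b'⟩ := h'
  obtain rfl : e = e' := H
  cases b <;> cases b' <;> simp [flipHalf]

/-! ### Connectivity and Euler's formula. -/

namespace Multigraph

variable {V E V' E' V'' E'' : Type*}

theorem toSimpleGraph_adj (G : Multigraph V E) {u v : V} :
    G.toSimpleGraph.Adj u v ↔ u ≠ v ∧ ∃ h, G.attach h = u ∧ G.attach (flipHalf h) = v := by
  unfold toSimpleGraph
  rw [SimpleGraph.fromRel_adj]
  refine and_congr_right fun _ => ⟨?_, ?_⟩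
  · rintro (⟨e, h1, h2⟩ | ⟨e, h1, h2⟩)
    · exact ⟨(e, false), h1, h2⟩
    · exact ⟨(e, true), h2, h1⟩
  · rintro ⟨⟨e, b⟩, h1, h2⟩
    cases b
    · exact Or.inl ⟨e, h1, h2⟩
    · exact Or.inr ⟨e, h2, h1⟩

theorem reachable_attach (G : Multigraph V E) (h : E × Bool) :
    G.toSimpleGraph.Reachable (G.attach h) (G.attach (flipHalf h)) := by
  by_cases hne : G.attach h = G.attach (flipHalf h)
  · rw [hne]
  · exact SimpleGraph.Adj.reachable (G.toSimpleGraph_adj.2 ⟨hne, h, rfl, rfl⟩)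

/-- The induction principle behind the connectivity arguments: a reflexive transitive relation need
only be checked across single half-edges. -/
theorem rel_of_reachable (G : Multigraph V E) {R : V → V → Prop} (hrefl : ∀ v, R v v)
    (htrans : ∀ u v w, R u v → R v w → R u w)
    (hR : ∀ h, R (G.attach h) (G.attach (flipHalf h))) {u v : V}
    (huv : G.toSimpleGraph.Reachable u v) : R u v := by
  rw [SimpleGraph.reachable_iff_reflTransGen] at huv
  induction huv with
  | refl => exact hrefl _
  | tail _ hbc ih =>
    obtain ⟨-, h, rfl, rfl⟩ := G.toSimpleGraph_adj.1 hbc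
    exact htrans _ _ _ ih (hR h)

theorem connected_iff (G : Multigraph V E) :
    G.Connected ↔ Nonempty V ∧ ∀ u v, G.toSimpleGraph.Reachable u v := by
  unfold Connected
  rw [SimpleGraph.connected_iff, and_comm]
  rfl

theorem Connected.reachable {G : Multigraph V E} (hG : G.Connected) (u v : V) :
    G.toSimpleGraph.Reachable u v := (G.connected_iff.1 hG).2 u v

theorem Connected.nonempty' {G : Multigraph V E} (hG : G.Connected) : Nonempty V :=
  (G.connected_iff.1 hG).1

/-- A map of vertices that sends the ends of each edge to connected vertices, and meets every
component, transfers connectedness. -/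
theorem Connected.map {G : Multigraph V E} {G' : Multigraph V' E'} (hG : G.Connected)
    (f : V → V')
    (hf : ∀ h, G'.toSimpleGraph.Reachable (f (G.attach h)) (f (G.attach (flipHalf h))))
    (hsurj : ∀ v', ∃ v, G'.toSimpleGraph.Reachable v' (f v)) : G'.Connected := by
  rw [connected_iff]
  refine ⟨hG.nonempty'.map f, fun u v => ?_⟩
  obtain ⟨a, ha⟩ := hsurj u
  obtain ⟨b, hb⟩ := hsurj v
  have := G.rel_of_reachable (R := fun x y => G'.toSimpleGraph.Reachable (f x) (f y))
    (fun _ => SimpleGraph.Reachable.refl _) (fun _ _ _ h1 h2 => h1.trans h2) hf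
    (hG.reachable a b)
  exact ha.trans (this.trans hb.symm)

/-- Euler's formula for connected graphs. -/
theorem Connected.loopNumber_add_card [Fintype V] [Fintype E] {G : Multigraph V E}
    (hG : G.Connected) : G.loopNumber + Fintype.card V = Fintype.card E + 1 := by
  classical
  obtain ⟨v₀⟩ := hG.nonempty'
  have h := (LinearMap.ker G.boundary).finrank_quotient_add_finrank
  rw [G.boundary.quotKerEquivRange.finrank_eq] at h
  -- The augmentation. By connectedness its kernel is the image of the boundary map, which therefore
  -- has rank `|V| - 1`.
  let aug : (V →₀ ℤ) →ₗ[ℤ] ℤ := Finsupp.linearCombination ℤ fun _ => (1 : ℤ)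
  have haug (v : V) (a : ℤ) : aug (Finsupp.single v a) = a := by simp [aug]
  have hle : LinearMap.range G.boundary ≤ LinearMap.ker aug := by
    rintro _ ⟨x, rfl⟩
    induction x using Finsupp.induction_linear with
    | zero => simp
    | add a b ha hb => rw [map_add]; exact add_mem ha hb
    | single e a => simp [boundary, aug]
  have hstep (v : V) :
      Finsupp.single v (1 : ℤ) - Finsupp.single v₀ 1 ∈ LinearMap.range G.boundary := by
    refine G.rel_of_reachable (R := fun u w =>
      Finsupp.single u (1 : ℤ) - Finsupp.single w 1 ∈ LinearMap.range G.boundary)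
      (fun v => by simp) (fun u v w h1 h2 => by simpa using add_mem h1 h2) ?_
      (hG.reachable v v₀)
    rintro ⟨e, b⟩
    have : G.boundary (Finsupp.single e 1) =
        Finsupp.single (G.ends e true) (1 : ℤ) - Finsupp.single (G.ends e false) (1 : ℤ) := by
      simp [boundary]
    cases b
    · rw [← neg_sub]
      exact neg_mem ⟨_, this⟩
    · exact ⟨_, this⟩
  have hall (x : V →₀ ℤ) :
      x - aug x • Finsupp.single v₀ (1 : ℤ) ∈ LinearMap.range G.boundary := by
    induction x using Finsupp.induction_linear with
    | zero => simp
    | add a b ha hb =>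
      have := add_mem ha hb
      rw [map_add, add_smul]
      convert this using 1
      abel
    | single v a =>
      have := Submodule.smul_mem _ a (hstep v)
      rw [haug]
      simpa [smul_sub] using this
  have heq : LinearMap.range G.boundary = LinearMap.ker aug := by
    refine le_antisymm hle fun x hx => ?_
    have := hall x
    rwa [LinearMap.mem_ker.1 hx, zero_smul, sub_zero] at this
  have h2 := (LinearMap.ker aug).finrank_quotient_add_finrank
  have hsurj : LinearMap.range aug = ⊤ :=
    LinearMap.range_eq_top.2 fun a => ⟨Finsupp.single v₀ a, haug _ _⟩
  rw [aug.quotKerEquivRange.finrank_eq, hsurj, finrank_top, ← heq] at h2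
  simp only [Module.finrank_finsupp_self, Module.finrank_self] at h h2
  unfold loopNumber
  omega

/-! ### Isomorphisms and invariance. -/

section Iso

@[ext]
theorem Iso.ext {G : Multigraph V E} {G' : Multigraph V' E'} {φ ψ : Iso G G'}
    (h1 : ∀ v, φ.vert v = ψ.vert v) (h2 : ∀ h, φ.half h = ψ.half h) : φ = ψ := by
  cases φ
  cases ψ
  congr
  · exact Equiv.ext h1
  · exact Equiv.ext h2

instance Iso.finite [Finite V] [Finite E] [Finite V'] [Finite E'] (G : Multigraph V E)
    (G' : Multigraph V' E') : Finite (Iso G G') := by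
  refine Finite.of_injective
    (fun φ : Iso G G' => ((φ.vert : V → V'), (φ.half : E × Bool → E' × Bool))) fun φ ψ h => ?_
  simp only [Prod.mk.injEq] at h
  exact Iso.ext (congrFun h.1) (congrFun h.2)

variable {G : Multigraph V E} {G' : Multigraph V' E'}

/-- Postcomposition with an isomorphism. -/
def Iso.congrRight {G'' : Multigraph V'' E''} (ψ : Iso G' G'') : Iso G G' ≃ Iso G G'' where
  toFun φ := φ.trans ψ
  invFun φ := φ.trans ψ.symm
  left_inv φ := by ext <;> simp [Iso.trans, Iso.symm]
  right_inv φ := by ext <;> simp [Iso.trans, Iso.symm]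

/-- An isomorphism built from a bijection of half-edges, when no vertex is isolated. -/
noncomputable def Iso.ofHalf (f : E × Bool ≃ E' × Bool)
    (hflip : ∀ h, f (flipHalf h) = flipHalf (f h))
    (hattach : ∀ h h', G.attach h = G.attach h' ↔ G'.attach (f h) = G'.attach (f h'))
    (hG : Function.Surjective G.attach) (hG' : Function.Surjective G'.attach) : Iso G G' where
  vert := Equiv.ofBijective (fun v => G'.attach (f (hG v).choose)) <| by
    refine ⟨fun v w h => ?_, fun v' => ?_⟩
    · have := (hattach _ _).2 h
      rwa [(hG v).choose_spec, (hG w).choose_spec] at this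
    · obtain ⟨h', rfl⟩ := hG' v'
      refine ⟨G.attach (f.symm h'), ?_⟩
      have := (hattach _ _).1 (hG (G.attach (f.symm h'))).choose_spec
      simpa using this
  half := f
  half_flip := hflip
  attach_half h := ((hattach _ _).1 (hG (G.attach h)).choose_spec).symm

/-- An isomorphism built from bijections of vertices and edges which preserve the direction of
the edges. -/
def Iso.ofEdges (f : V ≃ V') (k : E ≃ E') (h : ∀ e b, G'.ends (k e) b = f (G.ends e b)) :
    Iso G G' where
  vert := f
  half := Equiv.prodCongr k (Equiv.refl Bool)
  half_flip _ := rfl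
  attach_half x := h x.1 x.2

/-- Relabelling of the vertices and edges of a multigraph. -/
def relabel (G : Multigraph V E) (f : V ≃ V') (k : E ≃ E') : Multigraph V' E' where
  ends e b := f (G.ends (k.symm e) b)

def relabelIso (G : Multigraph V E) (f : V ≃ V') (k : E ≃ E') : Iso G (G.relabel f k) :=
  Iso.ofEdges f k fun e b => by simp [relabel]

theorem Iso.attach_flip_half (φ : Iso G G') (h : E × Bool) :
    G'.attach (flipHalf (φ.half h)) = φ.vert (G.attach (flipHalf h)) := by
  rw [← φ.half_flip, φ.attach_half]

theorem Iso.card_vert_eq [Fintype V] [Fintype V'] (φ : Iso G G') :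
    Fintype.card V = Fintype.card V' := Fintype.card_congr φ.vert

theorem Iso.card_edge_eq [Fintype E] [Fintype E'] (φ : Iso G G') :
    Fintype.card E = Fintype.card E' := by
  have := Fintype.card_congr φ.half
  simpa using this

theorem Iso.connected (φ : Iso G G') (hG : G.Connected) : G'.Connected := by
  refine hG.map φ.vert (fun h => ?_) fun v' => ⟨φ.vert.symm v', by simp⟩
  rw [← φ.attach_half, ← φ.attach_half, φ.half_flip]
  exact G'.reachable_attach _

theorem Iso.degree_eq (φ : Iso G G') (v : V) : G'.degree (φ.vert v) = G.degree v := by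
  refine (Nat.card_congr (φ.half.subtypeEquiv fun h => ?_)).symm
  rw [φ.attach_half, φ.vert.apply_eq_iff_eq]

theorem Iso.blackNeighbors_eq (φ : Iso G G') (c : V' → ZMod 2) (v : V) :
    G'.blackNeighbors c (φ.vert v) = G.blackNeighbors (fun v => c (φ.vert v)) v := by
  refine (Nat.card_congr (φ.half.subtypeEquiv fun h => ?_)).symm
  rw [φ.attach_half, φ.vert.apply_eq_iff_eq, φ.attach_flip_half]

theorem Iso.kind_eq (φ : Iso G G') (c : V' → ZMod 2) (v : V) :
    G'.kind c (φ.vert v) = G.kind (fun v => c (φ.vert v)) v := by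
  unfold kind
  rw [φ.blackNeighbors_eq]

theorem Iso.W_eq [Fintype V] [Fintype V'] (φ : Iso G G') : G.W = G'.W := by
  classical
  unfold W
  refine Fintype.sum_equiv (Equiv.arrowCongr φ.vert (Equiv.refl _)) _ _ fun c => ?_
  unfold coloringMonomial
  refine Fintype.prod_equiv φ.vert _ _ fun v => ?_
  rw [φ.kind_eq]
  simp

/-- Euler's formula reduces this to counting vertices and edges, so no signs for reversed edges have
to be tracked through the boundary map. -/
theorem Iso.loopNumber_eq [Fintype V] [Fintype V'] [Fintype E] [Fintype E'] (φ : Iso G G')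
    (hG : G.Connected) : G'.loopNumber = G.loopNumber := by
  have h1 := hG.loopNumber_add_card
  have h2 := (φ.connected hG).loopNumber_add_card
  rw [φ.card_vert_eq, φ.card_edge_eq] at h1
  omega

end Iso

/-- The number of half-edges, summed over the vertices to which they are attached. -/
theorem sum_degree [Fintype V] [Fintype E] (G : Multigraph V E) :
    ∑ v, G.degree v = 2 * Fintype.card E := by
  classical
  have := Fintype.card_congr (Equiv.sigmaFiberEquiv G.attach)
  rw [Fintype.card_sigma, Fintype.card_prod, Fintype.card_bool, mul_comm] at this
  rw [← this]
  exact Finset.sum_congr rfl fun v _ => by rw [degree, Nat.card_eq_fintype_card]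

/-! ### Half-edges and vertices of a subdivision. -/

variable {V E V' E' : Type*}

/-- The `i`-th half-edge on the path which replaces an edge in a subdivision, when walking along
the edge starting from its half-edge `h`. -/
def dart (k : E → ℕ) (h : E × Bool) (i : ℕ) (hi : i ≤ k h.1) : (Σ e, Fin (k e + 1)) × Bool :=
  (⟨h.1, ⟨if h.2 then k h.1 - i else i, by split <;> omega⟩⟩, h.2)

/-- The `j`-th new vertex on the path which replaces an edge in a subdivision, when walking along
the edge starting from its half-edge `h`. -/
def midVertex (V : Type*) (k : E → ℕ) (h : E × Bool) (j : ℕ) (hj : j < k h.1) :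
    V ⊕ (Σ e, Fin (k e)) :=
  Sum.inr ⟨h.1, ⟨if h.2 then k h.1 - 1 - j else j, by split <;> omega⟩⟩

theorem sub_le_flipHalf (k : E → ℕ) (h : E × Bool) (i : ℕ) : k h.1 - i ≤ k (flipHalf h).1 :=
  Nat.sub_le _ _

/-- `dart k h i` leaves the `i`-th vertex of the path, counted from the end of `h`, towards the
other end. Its partner is met when walking back, and the path has `k h.1 + 1` edges numbered from 0.
-/
theorem flipHalf_dart (k : E → ℕ) (h : E × Bool) (i : ℕ) (hi : i ≤ k h.1) :
    flipHalf (dart k h i hi) = dart k (flipHalf h) (k h.1 - i) (sub_le_flipHalf k h i) := by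
  obtain ⟨e, b⟩ := h
  have : k e - (k e - i) = i := Nat.sub_sub_self hi
  cases b <;> simp [dart, flipHalf, this]

theorem dart_inj {k : E → ℕ} {h h' : E × Bool} {i i' : ℕ} {hi : i ≤ k h.1} {hi' : i' ≤ k h'.1} :
    dart k h i hi = dart k h' i' hi' ↔ h = h' ∧ i = i' := by
  constructor
  · intro H
    obtain ⟨e, b⟩ := h
    obtain ⟨e', b'⟩ := h'
    simp only [dart, Prod.mk.injEq] at H
    obtain ⟨H, rfl⟩ := H
    obtain rfl : e = e' := congrArg Sigma.fst H
    simp only [Sigma.mk.injEq, heq_eq_eq, true_and, Fin.mk.injEq] at H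
    refine ⟨rfl, ?_⟩
    dsimp only at hi hi'
    cases b <;> simp at H <;> omega
  · rintro ⟨rfl, rfl⟩
    rfl

theorem exists_eq_dart (k : E → ℕ) (x : (Σ e, Fin (k e + 1)) × Bool) :
    ∃ h i hi, x = dart k h i hi := by
  obtain ⟨⟨e, ⟨i, hi⟩⟩, b⟩ := x
  cases b
  · exact ⟨(e, false), i, Nat.lt_succ_iff.1 hi, by simp [dart]⟩
  · refine ⟨(e, true), k e - i, Nat.sub_le _ _, ?_⟩
    have : k e - (k e - i) = i := Nat.sub_sub_self (Nat.lt_succ_iff.1 hi)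
    simp [dart, this]

theorem attach_subdivide_true_last (G : Multigraph V E) (k : E → ℕ) (e : E)
    (h : k e < k e + 1) :
    (G.subdivide k).ends ⟨e, ⟨k e, h⟩⟩ true = Sum.inl (G.ends e true) := by
  exact Fin.lastCases_last (motive := fun _ => V ⊕ (Σ e, Fin (k e)))
    (last := Sum.inl (G.ends e true)) (cast := fun j => Sum.inr ⟨e, j⟩)

theorem attach_subdivide_true_lt (G : Multigraph V E) (k : E → ℕ) (e : E) (j : ℕ)
    (h : j < k e + 1) (hj : j < k e) :
    (G.subdivide k).ends ⟨e, ⟨j, h⟩⟩ true = Sum.inr ⟨e, ⟨j, hj⟩⟩ := by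
  exact Fin.lastCases_castSucc (motive := fun _ => V ⊕ (Σ e, Fin (k e)))
    (last := Sum.inl (G.ends e true)) (cast := fun j => Sum.inr ⟨e, j⟩) ⟨j, hj⟩

theorem attach_dart_zero (G : Multigraph V E) (k : E → ℕ) (h : E × Bool) (h0 : 0 ≤ k h.1) :
    (G.subdivide k).attach (dart k h 0 h0) = Sum.inl (G.attach h) := by
  obtain ⟨e, b⟩ := h
  cases b
  · rfl
  · simp only [attach, dart, if_true, Nat.sub_zero]
    exact G.attach_subdivide_true_last k e _

theorem attach_dart_succ (G : Multigraph V E) (k : E → ℕ) (h : E × Bool) (j : ℕ)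
    (hj : j + 1 ≤ k h.1) :
    (G.subdivide k).attach (dart k h (j + 1) hj) = midVertex V k h j hj := by
  obtain ⟨e, b⟩ := h
  dsimp only at hj
  cases b
  · rfl
  · simp only [attach, dart, midVertex, if_true]
    rw [G.attach_subdivide_true_lt k e _ _ (by omega)]
    congr 3
    omega

theorem midVertex_eq_iff {k : E → ℕ} {h h' : E × Bool} {j j' : ℕ} {hj : j < k h.1}
    {hj' : j' < k h'.1} : midVertex V k h j hj = midVertex V k h' j' hj' ↔
      (h = h' ∧ j = j') ∨ (h = flipHalf h' ∧ j + j' + 1 = k h'.1) := by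
  obtain ⟨e, b⟩ := h
  obtain ⟨e', b'⟩ := h'
  simp only [midVertex, Sum.inr.injEq]
  by_cases he : e = e'
  · subst he
    simp only [Sigma.mk.injEq, heq_eq_eq, true_and, Fin.mk.injEq]
    dsimp only at hj hj'
    cases b <;> cases b' <;> simp [flipHalf] <;> omega
  · have : ¬ ((e, b) = flipHalf (e', b')) := fun H => he (congrArg Prod.fst H)
    simp [he, this]

/-- Expresses incidence purely by half-edges and positions, so that isomorphisms of subdivisions can
be built and analysed without mentioning vertices. The last alternative is an inserted vertex
reached from both ends of its path. -/
theorem attach_dart_eq_iff (G : Multigraph V E) {k : E → ℕ} {h h' : E × Bool} {i i' : ℕ}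
    {hi : i ≤ k h.1} {hi' : i' ≤ k h'.1} :
    (G.subdivide k).attach (dart k h i hi) = (G.subdivide k).attach (dart k h' i' hi') ↔
      (i = 0 ∧ i' = 0 ∧ G.attach h = G.attach h') ∨
        (i ≠ 0 ∧ i' ≠ 0 ∧ ((h = h' ∧ i = i') ∨ (h = flipHalf h' ∧ i + i' = k h'.1 + 1))) := by
  cases i with
  | zero =>
    cases i' with
    | zero => simp [attach_dart_zero]
    | succ i' => simp [attach_dart_zero, attach_dart_succ, midVertex]
  | succ i =>
    cases i' with
    | zero => simp [attach_dart_zero, attach_dart_succ, midVertex]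
    | succ i' =>
      rw [attach_dart_succ, attach_dart_succ, midVertex_eq_iff]
      have : i + i' + 1 = k h'.1 ↔ i + 1 + (i' + 1) = k h'.1 + 1 := by omega
      simp [this]

theorem exists_inl_eq_attach_dart_iff (G : Multigraph V E) {k : E → ℕ} {h : E × Bool} {i : ℕ}
    {hi : i ≤ k h.1} :
    (∃ v, (G.subdivide k).attach (dart k h i hi) = Sum.inl v) ↔ i = 0 := by
  cases i with
  | zero => simp [attach_dart_zero]
  | succ i => simp [attach_dart_succ, midVertex]

theorem exists_midVertex_eq (k : E → ℕ) (x : Σ e, Fin (k e)) :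
    ∃ h j hj, (Sum.inr x : V ⊕ (Σ e, Fin (k e))) = midVertex V k h j hj :=
  ⟨(x.1, false), x.2, x.2.2, by simp [midVertex]⟩

theorem attach_subdivide_surjective {G : Multigraph V E} (hG : Function.Surjective G.attach)
    (k : E → ℕ) : Function.Surjective (G.subdivide k).attach := by
  rintro (v | x)
  · obtain ⟨h, rfl⟩ := hG v
    exact ⟨_, G.attach_dart_zero k h (Nat.zero_le _)⟩
  · obtain ⟨h, j, hj, hx⟩ := exists_midVertex_eq (V := V) k x
    exact ⟨_, (G.attach_dart_succ k h j hj).trans hx.symm⟩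

theorem degree_subdivide_inl (G : Multigraph V E) (k : E → ℕ) (v : V) :
    (G.subdivide k).degree (Sum.inl v) = G.degree v := by
  refine (Nat.card_congr (Equiv.ofBijective
    (fun h : {h // G.attach h = v} => (⟨dart k h.1 0 (Nat.zero_le _), by
      rw [attach_dart_zero, h.2]⟩ : {x // (G.subdivide k).attach x = Sum.inl v})) ⟨?_, ?_⟩)).symm
  · rintro ⟨h, hh⟩ ⟨h', hh'⟩ H
    simp only [Subtype.mk.injEq, dart_inj] at H
    exact Subtype.ext H.1
  · rintro ⟨x, hx⟩
    obtain ⟨h, i, hi, rfl⟩ := exists_eq_dart k x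
    obtain rfl : i = 0 := G.exists_inl_eq_attach_dart_iff.1 ⟨v, hx⟩
    refine ⟨⟨h, ?_⟩, rfl⟩
    rw [attach_dart_zero] at hx
    exact Sum.inl.inj hx

theorem degree_subdivide_inr (G : Multigraph V E) (k : E → ℕ) (x : Σ e, Fin (k e)) :
    (G.subdivide k).degree (Sum.inr x) = 2 := by
  classical
  obtain ⟨h, j, hj, hx⟩ := exists_midVertex_eq (V := V) k x
  have h2 : (k h.1 - (j + 1)) + 1 ≤ k (flipHalf h).1 := by simp only [flipHalf]; omega
  -- The two half-edges at an inserted vertex point along the path in opposite directions.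
  have key : {y | (G.subdivide k).attach y = Sum.inr x} =
      ({dart k h (j + 1) hj, dart k (flipHalf h) (k h.1 - (j + 1) + 1) h2} : Finset _) := by
    ext y
    obtain ⟨h', i, hi, rfl⟩ := exists_eq_dart k y
    simp only [Set.mem_ofPred_eq, hx, ← G.attach_dart_succ k h j hj, attach_dart_eq_iff,
      Finset.coe_insert, Finset.coe_singleton, Set.mem_insert_iff, Set.mem_singleton_iff, dart_inj]
    constructor
    · rintro (⟨h1, h2, h3⟩ | ⟨h1, -, ⟨h3, h4⟩ | ⟨h3, h4⟩⟩)
      · omega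
      · exact Or.inl ⟨h3, h4⟩
      · exact Or.inr ⟨h3, by omega⟩
    · rintro (⟨h1, h3⟩ | ⟨h1, h3⟩)
      · exact Or.inr ⟨by omega, by omega, Or.inl ⟨h1, h3⟩⟩
      · exact Or.inr ⟨by omega, by omega, Or.inr ⟨h1, by omega⟩⟩
  change Nat.card ({y | (G.subdivide k).attach y = Sum.inr x} : Set _) = 2
  rw [key, Nat.card_coe_set_eq, Set.ncard_coe_finset, Finset.card_pair]
  rw [Ne, dart_inj]
  rintro ⟨H, -⟩
  exact flipHalf_ne h H.symm

theorem reachable_attach_dart (G : Multigraph V E) (k : E → ℕ) (h : E × Bool) (i : ℕ)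
    (hi : i ≤ k h.1) :
    (G.subdivide k).toSimpleGraph.Reachable (Sum.inl (G.attach h))
      ((G.subdivide k).attach (dart k h i hi)) := by
  induction i with
  | zero => rw [attach_dart_zero]
  | succ i ih =>
    refine (ih (by omega)).trans ?_
    convert (G.subdivide k).reachable_attach (dart k h i (by omega)) using 1
    rw [flipHalf_dart, attach_dart_eq_iff]
    refine Or.inr ⟨by omega, by omega, Or.inr ⟨(flipHalf_flipHalf h).symm, ?_⟩⟩
    change _ = k h.1 + 1
    omega

theorem subdivide_connected_iff (G : Multigraph V E) (k : E → ℕ) :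
    (G.subdivide k).Connected ↔ G.Connected := by
  constructor
  · intro H
    -- Contracts every path of inserted vertices to the end of the edge at its half `false`.
    let f : V ⊕ (Σ e, Fin (k e)) → V := Sum.elim id fun x => G.ends x.1 false
    have key (h i hi) : G.toSimpleGraph.Reachable (G.attach h)
        (f ((G.subdivide k).attach (dart k h i hi))) := by
      cases i with
      | zero => rw [attach_dart_zero]; rfl
      | succ i =>
        rw [attach_dart_succ]
        obtain ⟨e, b⟩ := h
        cases b
        · rfl
        · exact G.reachable_attach (e, true)
    refine H.map f (fun x => ?_) fun v => ⟨Sum.inl v, SimpleGraph.Reachable.refl _⟩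
    obtain ⟨h, i, hi, rfl⟩ := exists_eq_dart k x
    rw [flipHalf_dart]
    exact (key _ _ _).symm.trans ((G.reachable_attach h).trans (key _ _ _))
  · intro H
    refine H.map Sum.inl (fun h => ?_) ?_
    · refine (G.reachable_attach_dart k h (k h.1) le_rfl).trans ?_
      convert (G.subdivide k).reachable_attach (dart k h (k h.1) le_rfl) using 1
      rw [flipHalf_dart]
      simp only [Nat.sub_self]
      rw [attach_dart_zero]
    · rintro (v | x)
      · exact ⟨v, SimpleGraph.Reachable.refl _⟩
      · obtain ⟨h, j, hj, hx⟩ := exists_midVertex_eq (V := V) k x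
        refine ⟨G.attach h, ?_⟩
        rw [hx, ← G.attach_dart_succ]
        exact (G.reachable_attach_dart k h _ _).symm

/-- Each inserted vertex also adds one edge, so Euler's formula balances. -/
theorem subdivide_loopNumber [Fintype V] [Fintype E] {G : Multigraph V E} (hG : G.Connected)
    (k : E → ℕ) : (G.subdivide k).loopNumber = G.loopNumber := by
  have h1 := hG.loopNumber_add_card
  have h2 := ((G.subdivide_connected_iff k).2 hG).loopNumber_add_card
  simp only [Fintype.card_sum, Fintype.card_sigma, Fintype.card_fin, Finset.sum_add_distrib,
    Finset.sum_const, Finset.card_univ, smul_eq_mul, mul_one] at h2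
  omega

theorem Iso.ext_half {G : Multigraph V E} {G' : Multigraph V' E'}
    (hG : Function.Surjective G.attach) {φ ψ : Iso G G'} (h : ∀ x, φ.half x = ψ.half x) :
    φ = ψ := by
  refine Iso.ext (fun v => ?_) h
  obtain ⟨x, rfl⟩ := hG v
  rw [← φ.attach_half, ← ψ.attach_half, h]

theorem attach_surjective_of_degree {G : Multigraph V E} (h : ∀ v, G.degree v ≠ 0) :
    Function.Surjective G.attach := fun v => by
  have := (Nat.card_ne_zero.1 (h v)).1
  exact ⟨this.some.1, this.some.2⟩

/-- The half-edges of a subdivision. -/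
noncomputable def dartEquiv (k : E → ℕ) :
    (Σ h : E × Bool, Fin (k h.1 + 1)) ≃ (Σ e, Fin (k e + 1)) × Bool :=
  Equiv.ofBijective (fun x => dart k x.1 x.2 (Nat.lt_succ_iff.1 x.2.2)) <| by
    refine ⟨fun x y h => ?_, fun x => ?_⟩
    · obtain ⟨h1, h2⟩ := dart_inj.1 h
      obtain ⟨x, i⟩ := x
      obtain ⟨y, j⟩ := y
      dsimp only at h1 h2
      subst h1
      rw [Fin.ext h2]
    · obtain ⟨h, i, hi, rfl⟩ := exists_eq_dart k x
      exact ⟨⟨h, ⟨i, Nat.lt_succ_iff.2 hi⟩⟩, rfl⟩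

/-! ### Lifting isomorphisms to subdivisions. -/

section Functoriality

variable {G : Multigraph V E} {G' : Multigraph V' E'}

/-- The subdivision of the source of an isomorphism which corresponds to a given subdivision of
its target. -/
def Iso.pullback (ψ : Iso G G') (k' : E' → ℕ) (e : E) : ℕ := k' (ψ.half (e, false)).1

theorem Iso.pullback_apply (ψ : Iso G G') (k' : E' → ℕ) (h : E × Bool) :
    ψ.pullback k' h.1 = k' (ψ.half h).1 := by
  obtain ⟨e, b⟩ := h
  cases b
  · rfl
  · have := ψ.half_flip (e, false)
    change ψ.half (e, true) = _ at this
    rw [this]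
    rfl

/-- The bijection between half-edges of subdivisions induced by an isomorphism. -/
noncomputable def Iso.subdivideHalf (ψ : Iso G G') (k' : E' → ℕ) (k : E → ℕ)
    (hk : ψ.pullback k' = k) : (Σ e, Fin (k e + 1)) × Bool ≃ (Σ e, Fin (k' e + 1)) × Bool :=
  (dartEquiv k).symm.trans ((Equiv.sigmaCongr ψ.half fun h => finCongr (by
    rw [← hk, ψ.pullback_apply])).trans (dartEquiv k'))

theorem Iso.subdivideHalf_dart (ψ : Iso G G') (k' : E' → ℕ) (k : E → ℕ)
    (hk : ψ.pullback k' = k) (h : E × Bool) (i : ℕ) (hi : i ≤ k h.1)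
    (hi' : i ≤ k' (ψ.half h).1) :
    ψ.subdivideHalf k' k hk (dart k h i hi) = dart k' (ψ.half h) i hi' := by
  have : (dartEquiv k).symm (dart k h i hi) = ⟨h, ⟨i, Nat.lt_succ_iff.2 hi⟩⟩ := by
    rw [Equiv.symm_apply_eq]
    rfl
  unfold subdivideHalf
  rw [Equiv.trans_apply, this]
  rfl

/-- Subdivision is functorial. -/
noncomputable def Iso.subdivide (ψ : Iso G G') (k' : E' → ℕ) (k : E → ℕ)
    (hk : ψ.pullback k' = k) (hG : Function.Surjective G.attach) :
    Iso (G.subdivide k) (G'.subdivide k') :=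
  Iso.ofHalf (ψ.subdivideHalf k' k hk)
    (fun x => by
      obtain ⟨h, i, hi, rfl⟩ := exists_eq_dart k x
      have hk' : k h.1 = k' (ψ.half h).1 := by rw [← hk, ψ.pullback_apply]
      rw [flipHalf_dart, ψ.subdivideHalf_dart k' k hk h i hi (hk' ▸ hi), flipHalf_dart,
        ψ.subdivideHalf_dart _ _ _ _ _ _ (by rw [ψ.half_flip]; simp only [flipHalf]; omega),
        dart_inj]
      exact ⟨ψ.half_flip h, by omega⟩)
    (fun x y => by
      obtain ⟨h, i, hi, rfl⟩ := exists_eq_dart k x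
      obtain ⟨h', i', hi', rfl⟩ := exists_eq_dart k y
      have hk' (h : E × Bool) : k h.1 = k' (ψ.half h).1 := by rw [← hk, ψ.pullback_apply]
      rw [ψ.subdivideHalf_dart _ _ _ _ _ _ (hk' h ▸ hi),
        ψ.subdivideHalf_dart _ _ _ _ _ _ (hk' h' ▸ hi'), attach_dart_eq_iff, attach_dart_eq_iff,
        ψ.attach_half, ψ.attach_half, ψ.vert.apply_eq_iff_eq, ψ.half.apply_eq_iff_eq,
        ← ψ.half_flip, ψ.half.apply_eq_iff_eq, hk' h'])
    (attach_subdivide_surjective hG k)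
    (attach_subdivide_surjective (fun v' => by
      obtain ⟨h, hh⟩ := hG (ψ.vert.symm v')
      exact ⟨ψ.half h, by rw [ψ.attach_half, hh, Equiv.apply_symm_apply]⟩) k')

theorem Iso.subdivide_half (ψ : Iso G G') (k' : E' → ℕ) (k : E → ℕ)
    (hk : ψ.pullback k' = k) (hG : Function.Surjective G.attach) (h : E × Bool) (i : ℕ)
    (hi : i ≤ k h.1) (hi' : i ≤ k' (ψ.half h).1) :
    (ψ.subdivide k' k hk hG).half (dart k h i hi) = dart k' (ψ.half h) i hi' :=
  ψ.subdivideHalf_dart _ _ hk _ _ _ _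

end Functoriality

/-! ### Isomorphisms of subdivisions come from the underlying graphs. -/

section Uniqueness

variable {G : Multigraph V E} {G' : Multigraph V' E'} {k : E → ℕ} {k' : E' → ℕ}

/-- Inserted vertices have degree 2, so an isomorphism cannot send a vertex of degree at least 3 to
one of them. -/
theorem Iso.exists_vert_inl (Φ : Iso (G.subdivide k) (G'.subdivide k'))
    (hG : ∀ v, 3 ≤ G.degree v) (v : V) : ∃ v', Φ.vert (Sum.inl v) = Sum.inl v' := by
  rcases hv : Φ.vert (Sum.inl v) with v' | x
  · exact ⟨v', rfl⟩
  · have h1 := Φ.degree_eq (Sum.inl v)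
    rw [hv, degree_subdivide_inr, degree_subdivide_inl] at h1
    have := hG v
    omega

theorem Iso.exists_half_dart_zero (Φ : Iso (G.subdivide k) (G'.subdivide k'))
    (hG : ∀ v, 3 ≤ G.degree v) (h : E × Bool) : ∃ h',
      Φ.half (dart k h 0 (Nat.zero_le _)) = dart k' h' 0 (Nat.zero_le _) := by
  obtain ⟨h', i, hi, hx⟩ := exists_eq_dart k' (Φ.half (dart k h 0 (Nat.zero_le _)))
  have h1 := Φ.attach_half (dart k h 0 (Nat.zero_le _))
  rw [attach_dart_zero, hx] at h1
  obtain ⟨v', hv'⟩ := Φ.exists_vert_inl hG (G.attach h)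
  obtain rfl := G'.exists_inl_eq_attach_dart_iff.1 ⟨v', h1.trans hv'⟩
  exact ⟨h', hx⟩

/-- An isomorphism of subdivisions follows the paths which replace the edges. -/
theorem Iso.exists_half_dart (Φ : Iso (G.subdivide k) (G'.subdivide k'))
    (hG' : ∀ v, 3 ≤ G'.degree v) {h : E × Bool} {h' : E' × Bool}
    (hh : Φ.half (dart k h 0 (Nat.zero_le _)) = dart k' h' 0 (Nat.zero_le _)) (i : ℕ)
    (hi : i ≤ k h.1) : ∃ hi', Φ.half (dart k h i hi) = dart k' h' i hi' := by
  induction i with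
  | zero => exact ⟨_, hh⟩
  | succ i ih =>
    obtain ⟨hi', ih⟩ := ih (by omega)
    have h1 : (G.subdivide k).attach (flipHalf (dart k h i (by omega))) =
        (G.subdivide k).attach (dart k h (i + 1) hi) := by
      rw [flipHalf_dart, attach_dart_eq_iff]
      exact Or.inr ⟨by omega, by omega, Or.inr ⟨rfl, by omega⟩⟩
    have h2 := Φ.attach_flip_half (dart k h i (by omega))
    rw [h1, ← Φ.attach_half, ih] at h2
    obtain ⟨h'', i'', hi'', hx⟩ := exists_eq_dart k' (Φ.half (dart k h (i + 1) hi))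
    rw [hx, flipHalf_dart, attach_dart_eq_iff] at h2
    -- The next half-edge in the image starts at an old vertex, turns back, or continues along the
    -- path. Degrees exclude the first case and injectivity on half-edges the second.
    rcases h2 with ⟨-, rfl, -⟩ | ⟨h3, h4, ⟨rfl, rfl⟩ | ⟨h5, h6⟩⟩
    · exfalso
      have h3 := Φ.attach_half (dart k h (i + 1) hi)
      rw [hx, attach_dart_zero] at h3
      obtain ⟨v, hv⟩ := Φ.symm.exists_vert_inl hG' (G'.attach h'')
      have h4 : Φ.symm.vert (Sum.inl (G'.attach h'')) =
        (G.subdivide k).attach (dart k h (i + 1) hi) := by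
        rw [h3]
        exact Φ.vert.symm_apply_apply _
      have := G.exists_inl_eq_attach_dart_iff.1 ⟨v, h4.symm.trans hv⟩
      omega
    · exfalso
      have h7 : Φ.half (dart k h (i + 1) hi) = Φ.half (flipHalf (dart k h i (by omega))) := by
        rw [hx, Φ.half_flip, ih, flipHalf_dart]
      rw [Φ.half.apply_eq_iff_eq, flipHalf_dart, dart_inj] at h7
      exact flipHalf_ne _ h7.1.symm
    · have h8 : h'' = h' := by
        have := congrArg flipHalf h5
        rwa [flipHalf_flipHalf, flipHalf_flipHalf, eq_comm] at this
      subst h8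
      obtain rfl : i'' = i + 1 := by omega
      exact ⟨hi'', hx⟩

/-- An isomorphism of subdivisions of graphs with all degrees at least `3` comes from a unique
isomorphism of the graphs. -/
theorem Iso.exists_of_subdivide (Φ : Iso (G.subdivide k) (G'.subdivide k'))
    (hG : ∀ v, 3 ≤ G.degree v) (hG' : ∀ v, 3 ≤ G'.degree v) :
    ∃ ψ : Iso G G', ψ.pullback k' = k ∧
      ∀ h i hi, ∃ hi', Φ.half (dart k h i hi) = dart k' (ψ.half h) i hi' := by
  choose f hf using Φ.exists_vert_inl hG
  choose p hp using Φ.exists_half_dart_zero hG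
  have hfb : Function.Bijective f := by
    refine ⟨fun v w h => ?_, fun v' => ?_⟩
    · have := (hf v).trans ((congrArg Sum.inl h).trans (hf w).symm)
      exact Sum.inl.inj (Φ.vert.injective this)
    · obtain ⟨v, hv⟩ := Φ.symm.exists_vert_inl hG' v'
      refine ⟨v, Sum.inl.inj (β := Σ e, Fin (k' e)) ?_⟩
      rw [← hf, ← hv]
      exact Φ.vert.apply_symm_apply _
  have hpb : Function.Bijective p := by
    refine ⟨fun v w h => ?_, fun h' => ?_⟩
    · have := (hp v).trans ((dart_inj.2 ⟨h, rfl⟩).trans (hp w).symm)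
      exact (dart_inj.1 (Φ.half.injective this)).1
    · obtain ⟨h, hh⟩ := Φ.symm.exists_half_dart_zero hG' h'
      refine ⟨h, (dart_inj (k := k') (hi := Nat.zero_le _) (hi' := Nat.zero_le _) (i := 0)
        (i' := 0)).1 ?_ |>.1⟩
      rw [← hp, ← hh]
      exact Φ.half.apply_symm_apply _
  -- The last half-edge along `h` is the partner of the first one along `flipHalf h`. Comparing the
  -- images gives compatibility with flips and, at the same time, equality of path lengths.
  have hflip (h : E × Bool) : p (flipHalf h) = flipHalf (p h) ∧ k h.1 = k' (p h).1 := by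
    obtain ⟨hi', h1⟩ := Φ.exists_half_dart hG' (hp h) (k h.1) le_rfl
    have h2 := Φ.half_flip (dart k h (k h.1) le_rfl)
    rw [h1, flipHalf_dart, flipHalf_dart] at h2
    simp only [Nat.sub_self] at h2
    rw [hp, dart_inj] at h2
    exact ⟨h2.1, by omega⟩
  let ψ : Iso G G' :=
    { vert := Equiv.ofBijective f hfb
      half := Equiv.ofBijective p hpb
      half_flip := fun h => (hflip h).1
      attach_half := fun h => by
        have := Φ.attach_half (dart k h 0 (Nat.zero_le _))
        rw [hp, attach_dart_zero, attach_dart_zero, hf] at this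
        exact Sum.inl.inj this }
  exact ⟨ψ, funext fun e => (hflip (e, false)).2.symm, fun h i hi =>
    Φ.exists_half_dart hG' (hp h) i hi⟩

/-- Lifting by `Iso.subdivide` is inverse to the descent in `Iso.exists_of_subdivide`; the lengths
`k` are forced to be the pullback of `k'`. -/
theorem card_iso_subdivide (G : Multigraph V E) (G' : Multigraph V' E')
    (hG : ∀ v, 3 ≤ G.degree v) (hG' : ∀ v, 3 ≤ G'.degree v) (k : E → ℕ) (k' : E' → ℕ) :
    Nat.card (Iso (G.subdivide k) (G'.subdivide k')) =
      Nat.card {ψ : Iso G G' // ψ.pullback k' = k} := by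
  have hs : Function.Surjective G.attach :=
    attach_surjective_of_degree fun v => by have := hG v; omega
  refine (Nat.card_congr (Equiv.ofBijective
    (fun ψ : {ψ : Iso G G' // ψ.pullback k' = k} => ψ.1.subdivide k' k ψ.2 hs) ⟨?_, ?_⟩)).symm
  · rintro ⟨ψ, h1⟩ ⟨ψ', h2⟩ h
    refine Subtype.ext (Iso.ext_half hs fun x => ?_)
    have := congrArg (fun Φ => Φ.half (dart k x 0 (Nat.zero_le _))) h
    dsimp only at this
    rw [Iso.subdivide_half (hi' := Nat.zero_le _), Iso.subdivide_half (hi' := Nat.zero_le _),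
      dart_inj] at this
    exact this.1
  · intro Φ
    obtain ⟨ψ, h1, h2⟩ := Φ.exists_of_subdivide hG hG'
    refine ⟨⟨ψ, h1⟩, Iso.ext_half (attach_subdivide_surjective hs k) fun x => ?_⟩
    obtain ⟨h, i, hi, rfl⟩ := exists_eq_dart k x
    obtain ⟨hi', h3⟩ := h2 h i hi
    rw [h3]
    exact Iso.subdivide_half _ _ _ _ _ _ _ _ _

/-- Each isomorphism of the underlying graphs pulls `k'` back to exactly one `k`, so the summands
are the fibres of `pullback`. -/
theorem sum_card_iso_subdivide [Finite V] [Finite E] [Finite V'] [Finite E']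
    (G : Multigraph V E) (G' : Multigraph V' E')
    (hG : ∀ v, 3 ≤ G.degree v) (hG' : ∀ v, 3 ≤ G'.degree v) (k' : E' → ℕ)
    (K : Finset (E → ℕ)) (hK : ∀ ψ : Iso G G', ψ.pullback k' ∈ K) :
    ∑ k ∈ K, Nat.card (Iso (G.subdivide k) (G'.subdivide k')) = Nat.card (Iso G G') := by
  classical
  have := Fintype.ofFinite (Iso G G')
  simp_rw [card_iso_subdivide G G' hG hG', Nat.card_eq_fintype_card, Fintype.card_subtype]
  rw [← Finset.card_univ]
  exact (Finset.card_eq_sum_card_fiberwise fun ψ _ => hK ψ).symm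

end Uniqueness

/-! ### Smoothing vertices of degree 2. -/

theorem sigma_fin_eq_iff {α : Type*} {n : α → ℕ} {x y : Σ a, Fin (n a)} :
    x = y ↔ x.1 = y.1 ∧ (x.2 : ℕ) = y.2 := by
  refine ⟨fun h => h ▸ ⟨rfl, rfl⟩, fun ⟨h1, h2⟩ => ?_⟩
  obtain ⟨a, i⟩ := x
  obtain ⟨b, j⟩ := y
  dsimp only at h1
  subst h1
  obtain rfl : i = j := Fin.ext h2
  rfl

/-- The graph obtained by inserting a new vertex into the edge `none`. -/
def insertVertex {V E : Type*} (G : Multigraph V (Option E)) :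
    Multigraph (Option V) (Option (Option E)) where
  ends
    | none, false => some (G.ends none false)
    | none, true => none
    | some none, false => none
    | some none, true => some (G.ends none true)
    | some (some e), b => some (G.ends (some e) b)

/-- The number of vertices inserted into the edges of a graph, given the number of those inserted
into the edges of the graph with an additional vertex on the edge `none`. -/
def mergeLength {E : Type*} (k : Option (Option E) → ℕ) : Option E → ℕ
  | none => k none + k (some none) + 1
  | some e => k (some (some e))

/-- The paths replacing the two halves of the edge are concatenated; the inserted vertex itself
takes position `k none`, which accounts for the `+ 1` in `mergeLength`. -/
theorem nonempty_iso_subdivide_insertVertex {V E : Type*} (G : Multigraph V (Option E))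
    (k : Option (Option E) → ℕ) :
    Nonempty (Iso (G.insertVertex.subdivide k) (G.subdivide (mergeLength k))) := by
  let f : (Σ x, Fin (k x + 1)) → Σ x, Fin (mergeLength k x + 1)
    | ⟨none, i⟩ => ⟨none, ⟨i, by have := i.2; simp only [mergeLength]; omega⟩⟩
    | ⟨some none, i⟩ => ⟨none, ⟨k none + 1 + i, by have := i.2; simp only [mergeLength]; omega⟩⟩
    | ⟨some (some e), i⟩ => ⟨some e, i⟩
  let p : Option V ⊕ (Σ x, Fin (k x)) → V ⊕ Σ x, Fin (mergeLength k x)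
    | .inl (some v) => .inl v
    | .inl none => .inr ⟨none, ⟨k none, by simp only [mergeLength]; omega⟩⟩
    | .inr ⟨none, i⟩ => .inr ⟨none, ⟨i, by have := i.2; simp only [mergeLength]; omega⟩⟩
    | .inr ⟨some none, i⟩ =>
        .inr ⟨none, ⟨k none + 1 + i, by have := i.2; simp only [mergeLength]; omega⟩⟩
    | .inr ⟨some (some e), i⟩ => .inr ⟨some e, i⟩
  have hf : Function.Bijective f := by
    constructor
    · rintro ⟨_ | _ | e, i, hi⟩ ⟨_ | _ | e', i', hi'⟩ h <;>
        simp only [f, sigma_fin_eq_iff, reduceCtorEq, false_and, true_and, Option.some.injEq]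
          at h ⊢ <;> first | exact h | omega
    · rintro ⟨_ | e, i, hi⟩
      · simp only [mergeLength] at hi
        by_cases h : i ≤ k none
        · exact ⟨⟨none, ⟨i, by omega⟩⟩, rfl⟩
        · refine ⟨⟨some none, ⟨i - (k none + 1), by omega⟩⟩, ?_⟩
          simp only [f, sigma_fin_eq_iff, true_and]
          omega
      · exact ⟨⟨some (some e), ⟨i, hi⟩⟩, rfl⟩
  have hp : Function.Bijective p := by
    constructor
    · rintro ((_ | v) | ⟨_ | _ | e, i, hi⟩) ((_ | v') | ⟨_ | _ | e', i', hi'⟩) h <;>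
        simp only [p, sigma_fin_eq_iff, reduceCtorEq, false_and, true_and, Option.some.injEq,
          Sum.inr.injEq, Sum.inl.injEq] at h ⊢ <;> first | exact h | omega
    · rintro (v | ⟨_ | e, i, hi⟩)
      · exact ⟨.inl (some v), rfl⟩
      · simp only [mergeLength] at hi
        rcases lt_trichotomy i (k none) with h | rfl | h
        · exact ⟨.inr ⟨none, ⟨i, h⟩⟩, rfl⟩
        · exact ⟨.inl none, rfl⟩
        · refine ⟨.inr ⟨some none, ⟨i - (k none + 1), by omega⟩⟩, ?_⟩
          simp only [p, sigma_fin_eq_iff, true_and, Sum.inr.injEq]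
          omega
      · exact ⟨.inr ⟨some (some e), ⟨i, hi⟩⟩, rfl⟩
  refine ⟨Iso.ofEdges (Equiv.ofBijective p hp) (Equiv.ofBijective f hf) ?_⟩
  rintro ⟨x, i, hi⟩ (_ | _)
  · rcases i with _ | i
    · rcases x with _ | _ | e
      · rfl
      · rfl
      · rfl
    · rcases x with _ | _ | e
      · rfl
      · rfl
      · rfl
  · rcases Nat.lt_succ_iff_lt_or_eq.1 hi with h | rfl
    · rw [attach_subdivide_true_lt _ _ _ _ _ h]
      rcases x with _ | _ | e
      · exact attach_subdivide_true_lt _ _ _ _ _ _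
      · exact attach_subdivide_true_lt _ _ _ _ _ (by simp only [mergeLength]; omega)
      · exact attach_subdivide_true_lt _ _ _ _ _ _
    · rw [attach_subdivide_true_last]
      rcases x with _ | _ | e
      · exact attach_subdivide_true_lt _ _ _ _ _ _
      · have : f ⟨some none, ⟨k (some none), hi⟩⟩ =
            ⟨none, ⟨mergeLength k none, Nat.lt_succ_self _⟩⟩ := by
          simp only [f, mergeLength, sigma_fin_eq_iff, true_and]
          omega
        rw [Equiv.ofBijective_apply, this]
        exact attach_subdivide_true_last _ _ _ _
      · exact attach_subdivide_true_last _ _ _ _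

/-- A vertex of degree 2 can be smoothed unless it carries a loop. By connectedness the graph would
then be that single loop, with loop number 1, which `hl` excludes. -/
theorem exists_iso_insertVertex {V E : Type} [Fintype V] [Fintype E] {G : Multigraph V E}
    (hG : G.Connected) (hl : 2 ≤ G.loopNumber) {v : V} (hv : G.degree v = 2) :
    ∃ (V' E' : Type) (_ : Fintype V') (_ : Fintype E') (G' : Multigraph V' (Option E')),
      Fintype.card V' < Fintype.card V ∧ Nonempty (Iso G G'.insertVertex) := by
  classical
  obtain ⟨⟨h1, hh1⟩, ⟨h2, hh2⟩, hne, huniv⟩ := Nat.card_eq_two_iff.1 hv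
  have hall (h : E × Bool) (hh : G.attach h = v) : h = h1 ∨ h = h2 := by
    have : (⟨h, hh⟩ : {h // G.attach h = v}) ∈ ({⟨h1, hh1⟩, ⟨h2, hh2⟩} : Set _) := by
      rw [huniv]
      trivial
    simpa using this
  have hne' : h1 ≠ h2 := fun h => hne (Subtype.ext h)
  have hne1 : h1.1 ≠ h2.1 := by
    intro heq
    have h2eq : h2 = flipHalf h1 :=
      (eq_or_eq_flipHalf heq.symm).resolve_left hne'.symm
    have hV (w : V) : w = v := by
      refine G.rel_of_reachable (R := fun x y => x = v → y = v) (fun _ h => h)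
        (fun _ _ _ h h' h'' => h' (h h'')) ?_ (hG.reachable v w) rfl
      intro h hh
      rcases hall h hh with rfl | rfl
      · rw [← h2eq, hh2]
      · rw [h2eq, flipHalf_flipHalf, hh1]
    have hE (e : E) : e = h1.1 := by
      rcases hall (e, false) (hV _) with h | h
      · exact congrArg Prod.fst h
      · rw [heq]
        exact congrArg Prod.fst h
    have cV : Fintype.card V = 1 := Fintype.card_eq_one_iff.2 ⟨v, hV⟩
    have cE : Fintype.card E = 1 := Fintype.card_eq_one_iff.2 ⟨_, hE⟩
    have := hG.loopNumber_add_card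
    omega
  have hf1 : G.attach (flipHalf h1) ≠ v := fun h => by
    rcases hall _ h with h | h
    · exact flipHalf_ne _ h
    · exact hne1 (congrArg Prod.fst h : (flipHalf h1).1 = h2.1)
  have hf2 : G.attach (flipHalf h2) ≠ v := fun h => by
    rcases hall _ h with h | h
    · exact hne1 (congrArg Prod.fst h : (flipHalf h2).1 = h1.1).symm
    · exact flipHalf_ne _ h
  have hother (e : {e // e ≠ h1.1 ∧ e ≠ h2.1}) (b : Bool) : G.ends e b ≠ v := fun h => by
    rcases hall (e, b) h with h | h
    · exact e.2.1 (congrArg Prod.fst h)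
    · exact e.2.2 (congrArg Prod.fst h)
  -- The vertex `v` is deleted and its two edges are fused into the edge `none`. The far ends differ
  -- from `v`, but may coincide with each other.
  let G' : Multigraph {u // u ≠ v} (Option {e // e ≠ h1.1 ∧ e ≠ h2.1}) :=
    { ends := fun x b => match x, b with
        | none, false => ⟨_, hf1⟩
        | none, true => ⟨_, hf2⟩
        | some e, b => ⟨_, hother e b⟩ }
  let f : Option (Option {e // e ≠ h1.1 ∧ e ≠ h2.1}) × Bool → E × Bool
    | (none, false) => flipHalf h1
    | (none, true) => h1
    | (some none, false) => h2
    | (some none, true) => flipHalf h2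
    | (some (some e), b) => (e, b)
  have hf : Function.Bijective f := by
    rw [Fintype.bijective_iff_surjective_and_card]
    constructor
    · rintro ⟨e, b⟩
      by_cases he1 : e = h1.1
      · rcases eq_or_eq_flipHalf (h := (e, b)) he1 with h | h
        · exact ⟨(none, true), h.symm⟩
        · exact ⟨(none, false), h.symm⟩
      by_cases he2 : e = h2.1
      · rcases eq_or_eq_flipHalf (h := (e, b)) he2 with h | h
        · exact ⟨(some none, false), h.symm⟩
        · exact ⟨(some none, true), h.symm⟩
      exact ⟨(some (some ⟨e, he1, he2⟩), b), rfl⟩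
    · have : (Finset.univ.filter fun e : E => e ≠ h1.1 ∧ e ≠ h2.1) = {h1.1, h2.1}ᶜ := by
        ext e
        simp
      have h3 : Finset.card {h1.1, h2.1} ≤ Fintype.card E := Finset.card_le_univ _
      rw [Finset.card_pair hne1] at h3
      simp only [Fintype.card_prod, Fintype.card_option, Fintype.card_bool, Fintype.card_subtype, this,
        Finset.card_compl, Finset.card_pair hne1]
      omega
  let φ : Iso G'.insertVertex G :=
    { vert := Equiv.optionSubtypeNe v
      half := Equiv.ofBijective f hf
      half_flip := by
        rintro ⟨_ | _ | e, _ | _⟩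
        · exact (flipHalf_flipHalf _).symm
        · rfl
        · rfl
        · exact (flipHalf_flipHalf _).symm
        · rfl
        · rfl
      attach_half := by
        rintro ⟨_ | _ | e, _ | _⟩
        · rfl
        · exact hh1
        · exact hh2
        · rfl
        · rfl
        · rfl }
  refine ⟨_, _, inferInstance, inferInstance, G', ?_, ⟨φ.symm⟩⟩
  have := Fintype.card_congr (Equiv.optionSubtypeNe v)
  rw [Fintype.card_option] at this
  omega

/-- A connected graph with loop number at least `2` and all degrees at least `2` is a subdivision
of a graph with all degrees at least `3`. -/
theorem exists_iso_subdivide {V₀ E₀ : Type} (C : Multigraph V₀ E₀) [Fintype V₀] [Fintype E₀]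
    (hC : C.Connected) (hl : 2 ≤ C.loopNumber) (hdeg : ∀ v, 2 ≤ C.degree v) :
    ∃ (V E : Type) (_ : Fintype V) (_ : Fintype E) (G : Multigraph V E) (k : E → ℕ),
      (∀ v, 3 ≤ G.degree v) ∧ Nonempty (Iso C (G.subdivide k)) := by
  classical
  -- Induction on the number of vertices of a graph of which `C` is a subdivision, starting from `C`
  -- itself with nothing inserted.
  suffices H : ∀ (n : ℕ) (V E : Type) [Fintype V] [Fintype E] (G : Multigraph V E) (k : E → ℕ),
      Fintype.card V = n → Nonempty (Iso C (G.subdivide k)) →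
      ∃ (V E : Type) (_ : Fintype V) (_ : Fintype E) (G : Multigraph V E) (k : E → ℕ),
        (∀ v, 3 ≤ G.degree v) ∧ Nonempty (Iso C (G.subdivide k)) by
    have : IsEmpty (Σ _ : E₀, Fin 0) := ⟨fun x => x.2.elim0⟩
    refine H _ V₀ E₀ C (fun _ => 0) rfl ⟨Iso.ofEdges ((Equiv.sumEmpty _ _).symm)
      ((Equiv.prodUnique E₀ (Fin 1)).symm.trans (Equiv.sigmaEquivProd E₀ (Fin 1)).symm) ?_⟩
    rintro e (_ | _)
    · rfl
    · exact C.attach_subdivide_true_last _ _ _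
  intro n
  induction n using Nat.strong_induction_on with
  | _ n ih =>
    intro V E _ _ G k hn ⟨Φ⟩
    by_cases hG : ∀ v, 3 ≤ G.degree v
    · exact ⟨V, E, inferInstance, inferInstance, G, k, hG, ⟨Φ⟩⟩
    obtain ⟨v, hv⟩ := not_forall.1 hG
    have hd (v : V) : 2 ≤ G.degree v := by
      rw [← G.degree_subdivide_inl k, ← Φ.symm.degree_eq]
      exact hdeg _
    have hconn : G.Connected := (G.subdivide_connected_iff k).1 (Φ.connected hC)
    have hloop : G.loopNumber = C.loopNumber := by
      rw [← Φ.loopNumber_eq hC, subdivide_loopNumber hconn]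
    obtain ⟨V', E', _, _, G', hcard, ⟨φ⟩⟩ := exists_iso_insertVertex hconn (hloop ▸ hl)
      (v := v) (by have := hd v; omega)
    obtain ⟨Ψ⟩ := nonempty_iso_subdivide_insertVertex G' (φ.symm.pullback k)
    refine ih _ (hn ▸ hcard) V' (Option E') G' _ rfl ⟨Φ.trans (Iso.trans ?_ Ψ)⟩
    refine (φ.symm.subdivide k _ rfl ?_).symm
    refine attach_surjective_of_degree fun v => ?_
    rw [← φ.symm.degree_eq]
    have := hd (φ.symm.vert v)
    omega

/-! ### The 2-core and parent edges. -/

section Core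

variable {V E V' E' : Type*}

/-- Every vertex of `U` has at least two half-edges whose edges stay in `U`. -/
def IsDense (G : Multigraph V E) (U : Set V) : Prop :=
  ∀ v ∈ U, ∃ h₁ h₂, h₁ ≠ h₂ ∧ G.attach h₁ = v ∧ G.attach h₂ = v ∧
    G.attach (flipHalf h₁) ∈ U ∧ G.attach (flipHalf h₂) ∈ U

/-- The vertices of the `2`-core. -/
def core (G : Multigraph V E) : Set V := {v | ∃ U, G.IsDense U ∧ v ∈ U}

theorem IsDense.subset_core {G : Multigraph V E} {U : Set V} (hU : G.IsDense U) : U ⊆ G.core :=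
  fun _ hv => ⟨U, hU, hv⟩

theorem isDense_core (G : Multigraph V E) : G.IsDense G.core := by
  rintro v ⟨U, hU, hv⟩
  obtain ⟨h₁, h₂, h0, h1, h2, h3, h4⟩ := hU v hv
  exact ⟨h₁, h₂, h0, h1, h2, hU.subset_core h3, hU.subset_core h4⟩

theorem Iso.map_mem_core {G : Multigraph V E} {G' : Multigraph V' E'} (φ : Iso G G') {v : V}
    (hv : v ∈ G.core) : φ.vert v ∈ G'.core := by
  obtain ⟨U, hU, hv⟩ := hv
  refine ⟨φ.vert '' U, ?_, ⟨v, hv, rfl⟩⟩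
  rintro _ ⟨u, hu, rfl⟩
  obtain ⟨h₁, h₂, h0, h1, h2, h3, h4⟩ := hU u hu
  refine ⟨φ.half h₁, φ.half h₂, fun h => h0 (φ.half.injective h), ?_, ?_, ?_, ?_⟩
  · rw [φ.attach_half, h1]
  · rw [φ.attach_half, h2]
  · rw [φ.attach_flip_half]
    exact ⟨_, h3, rfl⟩
  · rw [φ.attach_flip_half]
    exact ⟨_, h4, rfl⟩

/-- In a connected graph, one can walk from any vertex to a given nonempty set of vertices by
successively choosing half-edges which decrease a rank function. -/
theorem Connected.exists_parent {G : Multigraph V E} (hG : G.Connected) {S : Set V}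
    (hS : S.Nonempty) : ∃ (d : V → ℕ) (p : {u // u ∉ S} → E × Bool),
      (∀ u, G.attach (p u) = u) ∧ ∀ u, d (G.attach (flipHalf (p u))) < d u := by
  classical
  obtain ⟨s₀, hs₀⟩ := hS
  -- The rank is the distance to `S`; the first step of a shortest walk lowers it.
  have hex (u : V) : ∃ n, ∃ s ∈ S, ∃ w : G.toSimpleGraph.Walk u s, w.length = n := by
    obtain ⟨w⟩ := hG.reachable u s₀
    exact ⟨_, s₀, hs₀, w, rfl⟩
  have hstep (u : {u // u ∉ S}) : ∃ h, G.attach h = u ∧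
      Nat.find (hex (G.attach (flipHalf h))) < Nat.find (hex u) := by
    obtain ⟨s, hs, w, hw⟩ := Nat.find_spec (hex u)
    cases w with
    | nil => exact absurd hs u.2
    | cons hadj w =>
      obtain ⟨-, h, h1, h2⟩ := G.toSimpleGraph_adj.1 hadj
      refine ⟨h, h1, ?_⟩
      rw [← hw, SimpleGraph.Walk.length_cons]
      refine lt_of_le_of_lt (Nat.find_min' _ ⟨s, hs, ?_⟩) (Nat.lt_succ_self w.length)
      rw [h2]
      exact ⟨w, rfl⟩
  choose p hp using hstep
  exact ⟨fun u => Nat.find (hex u), p, fun u => (hp u).1, fun u => (hp u).2⟩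

/-- If two vertices shared a parent edge, they would be its two ends, each of smaller rank than the
other. -/
theorem parentEdge_injective (G : Multigraph V E) {S : Set V} {d : V → ℕ}
    {p : {u // u ∉ S} → E × Bool} (hp : ∀ u, G.attach (p u) = u)
    (hd : ∀ u, d (G.attach (flipHalf (p u))) < d u) : Function.Injective fun u => (p u).1 := by
  intro u v h
  rcases eq_or_eq_flipHalf h with h | h
  · exact Subtype.ext (by rw [← hp u, h, hp])
  · exfalso
    have h1 := hd u
    have h2 := hd v
    rw [h, flipHalf_flipHalf, hp v, ← hp u, h] at h1
    exact lt_asymm h1 h2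

end Core

/-! ### Attaching rooted graphs, and isomorphisms of the result. -/

section Assemble

variable {V E V' E' : Type*} {VT ET : V → Type*} {VT' ET' : V' → Type*}

/-- The graph obtained from `C` by attaching the graphs `T v` at the vertices `v` of `C`, along
the roots `r v`. -/
def assemble (C : Multigraph V E) (T : ∀ v, Multigraph (VT v) (ET v)) (r : ∀ v, VT v) :
    Multigraph (Σ v, VT v) (E ⊕ Σ v, ET v) where
  ends
    | .inl e, b => ⟨C.ends e b, r _⟩
    | .inr ⟨v, e⟩, b => ⟨v, (T v).ends e b⟩

/-- The half-edges of an assembled graph. -/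
def halfSum (E : Type*) (ET : V → Type*) :
    (E × Bool) ⊕ (Σ v, ET v × Bool) ≃ (E ⊕ Σ v, ET v) × Bool where
  toFun
    | .inl h => (.inl h.1, h.2)
    | .inr ⟨v, h⟩ => (.inr ⟨v, h.1⟩, h.2)
  invFun
    | (.inl e, b) => .inl (e, b)
    | (.inr ⟨v, e⟩, b) => .inr ⟨v, (e, b)⟩
  left_inv := by rintro (h | ⟨v, h⟩) <;> rfl
  right_inv := by rintro ⟨e | ⟨v, e⟩, b⟩ <;> rfl

theorem flipHalf_halfSum_inl (h : E × Bool) :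
    flipHalf (halfSum E ET (.inl h)) = halfSum E ET (.inl (flipHalf h)) := rfl

theorem flipHalf_halfSum_inr (v : V) (h : ET v × Bool) :
    flipHalf (halfSum E ET (.inr ⟨v, h⟩)) = halfSum E ET (.inr ⟨v, flipHalf h⟩) := rfl

variable (C : Multigraph V E) (T : ∀ v, Multigraph (VT v) (ET v)) (r : ∀ v, VT v)
  (C' : Multigraph V' E') (T' : ∀ v, Multigraph (VT' v) (ET' v)) (r' : ∀ v, VT' v)

theorem attach_assemble_inl (h : E × Bool) :
    (C.assemble T r).attach (halfSum E ET (.inl h)) = ⟨C.attach h, r _⟩ := rfl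

theorem attach_assemble_inr (v : V) (h : ET v × Bool) :
    (C.assemble T r).attach (halfSum E ET (.inr ⟨v, h⟩)) = ⟨v, (T v).attach h⟩ := rfl

variable {C T r C' T' r'} in
/-- Isomorphisms between assembled graphs built from isomorphisms of their parts. -/
def Iso.assemble (φ : Iso C C') (ψ : ∀ v, Iso (T v) (T' (φ.vert v)))
    (hψ : ∀ v, (ψ v).vert (r v) = r' (φ.vert v)) :
    Iso (C.assemble T r) (C'.assemble T' r') where
  vert := Equiv.sigmaCongr φ.vert fun v => (ψ v).vert
  half := (halfSum E ET).symm.trans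
    ((Equiv.sumCongr φ.half (Equiv.sigmaCongr φ.vert fun v => (ψ v).half)).trans (halfSum E' ET'))
  half_flip x := by
    obtain ⟨h | ⟨v, h⟩, rfl⟩ := (halfSum E ET).surjective x
    · change halfSum E' ET' (.inl (φ.half (flipHalf h))) =
        flipHalf (halfSum E' ET' (.inl (φ.half h)))
      rw [φ.half_flip, flipHalf_halfSum_inl]
    · change halfSum E' ET' (.inr ⟨φ.vert v, (ψ v).half (flipHalf h)⟩) =
        flipHalf (halfSum E' ET' (.inr ⟨φ.vert v, (ψ v).half h⟩))
      rw [(ψ v).half_flip, flipHalf_halfSum_inr]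
  attach_half x := by
    obtain ⟨h | ⟨v, h⟩, rfl⟩ := (halfSum E ET).surjective x
    · change (⟨C'.attach (φ.half h), r' _⟩ : Σ v, VT' v) =
        ⟨φ.vert (C.attach h), (ψ _).vert (r (C.attach h))⟩
      rw [φ.attach_half, hψ]
    · change (⟨φ.vert v, (T' (φ.vert v)).attach ((ψ v).half h)⟩ : Σ v, VT' v) =
        ⟨φ.vert v, (ψ v).vert ((T v).attach h)⟩
      rw [(ψ v).attach_half]

variable {C T r C' T' r'} in
theorem Iso.assemble_vert (φ : Iso C C') (ψ : ∀ v, Iso (T v) (T' (φ.vert v)))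
    (hψ : ∀ v, (ψ v).vert (r v) = r' (φ.vert v)) (v : V) (u : VT v) :
    (φ.assemble ψ hψ).vert ⟨v, u⟩ = ⟨φ.vert v, (ψ v).vert u⟩ := rfl

variable {C T r C' T' r'} in
theorem Iso.assemble_half_inl (φ : Iso C C') (ψ : ∀ v, Iso (T v) (T' (φ.vert v)))
    (hψ : ∀ v, (ψ v).vert (r v) = r' (φ.vert v)) (h : E × Bool) :
    (φ.assemble ψ hψ).half (halfSum E ET (.inl h)) = halfSum E' ET' (.inl (φ.half h)) := rfl

variable {C T r C' T' r'} in
theorem Iso.assemble_half_inr (φ : Iso C C') (ψ : ∀ v, Iso (T v) (T' (φ.vert v)))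
    (hψ : ∀ v, (ψ v).vert (r v) = r' (φ.vert v)) (v : V) (h : ET v × Bool) :
    (φ.assemble ψ hψ).half (halfSum E ET (.inr ⟨v, h⟩)) =
      halfSum E' ET' (.inr ⟨φ.vert v, (ψ v).half h⟩) := rfl

variable {C T} in
theorem Connected.assemble (hC : C.Connected) (hT : ∀ v, (T v).Connected) :
    (C.assemble T r).Connected := by
  refine hC.map (fun v => ⟨v, r v⟩) (fun h => ?_) ?_
  · exact (C.assemble T r).reachable_attach (halfSum E ET (.inl h))
  · rintro ⟨v, u⟩
    refine ⟨v, (T v).rel_of_reachable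
      (R := fun x y => (C.assemble T r).toSimpleGraph.Reachable ⟨v, x⟩ ⟨v, y⟩)
      (fun _ => SimpleGraph.Reachable.refl _) (fun _ _ _ h h' => h.trans h') (fun h => ?_)
      ((hT v).reachable u (r v))⟩
    exact (C.assemble T r).reachable_attach (halfSum E ET (.inr ⟨v, h⟩))

variable {C T} in
theorem loopNumber_assemble [Fintype V] [Fintype E] [∀ v, Fintype (VT v)] [∀ v, Fintype (ET v)]
    (hC : C.Connected) (hT : ∀ v, (T v).Connected) (hT0 : ∀ v, (T v).loopNumber = 0) :
    (C.assemble T r).loopNumber = C.loopNumber := by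
  have h1 := hC.loopNumber_add_card
  have h2 := (hC.assemble r hT).loopNumber_add_card
  have h3 (v : V) : Fintype.card (VT v) = Fintype.card (ET v) + 1 := by
    have := (hT v).loopNumber_add_card
    rwa [hT0, zero_add] at this
  simp only [Fintype.card_sum, Fintype.card_sigma, h3, Finset.sum_add_distrib,
    Finset.sum_const, Finset.card_univ, smul_eq_mul, mul_one] at h2
  omega

theorem exists_ne_of_two_le_degree [Finite E] {C : Multigraph V E} {v : V}
    (h : 2 ≤ C.degree v) : ∃ h₁ h₂, h₁ ≠ h₂ ∧ C.attach h₁ = v ∧ C.attach h₂ = v := by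
  have : Nontrivial {h // C.attach h = v} := Finite.one_lt_card_iff_nontrivial.1 h
  obtain ⟨x, y, hxy⟩ := exists_pair_ne {h // C.attach h = v}
  exact ⟨x, y, fun h => hxy (Subtype.ext h), x.2, y.2⟩

variable {C T} in
/-- The core of a graph assembled from trees consists of the roots. -/
theorem core_assemble [Finite E] [∀ v, Fintype (VT v)] [∀ v, Fintype (ET v)]
    (hdeg : ∀ v, 2 ≤ C.degree v) (hT : ∀ v, (T v).Connected)
    (hT0 : ∀ v, (T v).loopNumber = 0) :
    (C.assemble T r).core = Set.range fun v => (⟨v, r v⟩ : Σ v, VT v) := by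
  classical
  apply subset_antisymm
  · rintro ⟨v, u⟩ ⟨U, hU, hu⟩
    by_contra hne
    have hur : u ≠ r v := fun h => hne ⟨v, by rw [h]⟩
    obtain ⟨d, p, hp, hd⟩ := (hT v).exists_parent (Set.singleton_nonempty (r v))
    have hinj := (T v).parentEdge_injective hp hd
    -- A tree has as many edges as non-root vertices, so every edge is a parent edge.
    have hsurj : Function.Surjective fun u => (p u).1 := by
      refine ((Fintype.bijective_iff_injective_and_card _).2 ⟨hinj, ?_⟩).2
      have h1 := (hT v).loopNumber_add_card
      have h2 := Fintype.card_subtype_compl (fun u => u ∈ ({r v} : Set (VT v)))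
      have h3 : Fintype.card {u // u ∈ ({r v} : Set (VT v))} = 1 := by simp
      rw [hT0 v] at h1
      omega
    -- Among the non-root vertices of `U` in this tree, choose one of largest rank. Every half-edge
    -- at it other than its parent half-edge leads to a vertex of larger rank, so only one half-edge
    -- stays in `U`.
    obtain ⟨u, hu, hmax⟩ := Finset.exists_max_image
      (Finset.univ.filter fun u => (⟨v, u⟩ : Σ v, VT v) ∈ U ∧ u ≠ r v) d
      ⟨u, Finset.mem_filter.2 ⟨Finset.mem_univ _, hu, hur⟩⟩
    rw [Finset.mem_filter] at hu
    obtain ⟨-, hu, hur⟩ := hu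
    obtain ⟨h₁, h₂, h0, h1, h2, h3, h4⟩ := hU _ hu
    have key (h) (hh : (C.assemble T r).attach h = ⟨v, u⟩)
        (hh' : (C.assemble T r).attach (flipHalf h) ∈ U) :
        h = halfSum E ET (.inr ⟨v, p ⟨u, hur⟩⟩) := by
      obtain ⟨h | ⟨v', h⟩, rfl⟩ := (halfSum E ET).surjective h
      · rw [attach_assemble_inl] at hh
        obtain ⟨rfl, h'⟩ := Sigma.mk.inj_iff.1 hh
        exact absurd (eq_of_heq h').symm hur
      · rw [attach_assemble_inr] at hh
        obtain ⟨rfl, h'⟩ := Sigma.mk.inj_iff.1 hh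
        have h' := eq_of_heq h'
        obtain ⟨w, hw⟩ := hsurj h.1
        rcases eq_or_eq_flipHalf hw.symm with h'' | h''
        · obtain rfl : w = ⟨u, hur⟩ := Subtype.ext (by rw [← hp w, ← h'', h'])
          rw [h'']
        · exfalso
          rw [flipHalf_halfSum_inr, attach_assemble_inr, h'', flipHalf_flipHalf, hp] at hh'
          have h5 := hmax w (Finset.mem_filter.2 ⟨Finset.mem_univ _, hh', w.2⟩)
          have h6 := hd w
          rw [← h'', h'] at h6
          omega
    exact h0 ((key _ h1 h3).trans (key _ h2 h4).symm)
  · refine IsDense.subset_core ?_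
    rintro _ ⟨v, rfl⟩
    obtain ⟨h₁, h₂, h0, h1, h2⟩ := exists_ne_of_two_le_degree (hdeg v)
    refine ⟨halfSum E ET (.inl h₁), halfSum E ET (.inl h₂), fun h => h0 ?_, ?_, ?_, ?_, ?_⟩
    · simpa using h
    · rw [attach_assemble_inl, h1]
    · rw [attach_assemble_inl, h2]
    · exact ⟨_, rfl⟩
    · exact ⟨_, rfl⟩

variable {C T r C' T' r'}

/-- Both ends of a core edge are roots. A tree edge whose ends are both roots would be a loop at its
root, which `hT` forbids. -/
theorem Iso.exists_half_inl (hT : ∀ v e, ¬ ((T' v).ends e false = r' v ∧ (T' v).ends e true = r' v))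
    (Φ : Iso (C.assemble T r) (C'.assemble T' r'))
    (hΦ : ∀ v, ∃ v', Φ.vert ⟨v, r v⟩ = ⟨v', r' v'⟩) (h : E × Bool) :
    ∃ h', Φ.half (halfSum E ET (.inl h)) = halfSum E' ET' (.inl h') := by
  obtain ⟨h' | ⟨v', x⟩, hx⟩ := (halfSum E' ET').surjective (Φ.half (halfSum E ET (.inl h)))
  · exact ⟨h', hx.symm⟩
  · exfalso
    have h1 := Φ.attach_half (halfSum E ET (.inl h))
    have h2 := Φ.attach_flip_half (halfSum E ET (.inl h))
    rw [← hx, flipHalf_halfSum_inr, attach_assemble_inr, flipHalf_halfSum_inl,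
      attach_assemble_inl] at h2
    rw [← hx, attach_assemble_inr, attach_assemble_inl] at h1
    obtain ⟨w, hw⟩ := hΦ (C.attach h)
    obtain ⟨w', hw'⟩ := hΦ (C.attach (flipHalf h))
    rw [hw] at h1
    rw [hw'] at h2
    obtain ⟨rfl, h1⟩ := Sigma.mk.inj_iff.1 h1
    obtain ⟨rfl, h2⟩ := Sigma.mk.inj_iff.1 h2
    obtain ⟨e, b⟩ := x
    cases b
    · exact hT _ _ ⟨eq_of_heq h1, eq_of_heq h2⟩
    · exact hT _ _ ⟨eq_of_heq h2, eq_of_heq h1⟩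

theorem Iso.exists_half_inr (hT : ∀ v e, ¬ ((T v).ends e false = r v ∧ (T v).ends e true = r v))
    (Φ : Iso (C.assemble T r) (C'.assemble T' r'))
    (hΦ' : ∀ v', ∃ v, Φ.symm.vert ⟨v', r' v'⟩ = ⟨v, r v⟩) (v : V) (x : ET v × Bool) :
    ∃ v' x', Φ.half (halfSum E ET (.inr ⟨v, x⟩)) = halfSum E' ET' (.inr ⟨v', x'⟩) := by
  obtain ⟨h' | ⟨v', x'⟩, hx⟩ := (halfSum E' ET').surjective (Φ.half (halfSum E ET (.inr ⟨v, x⟩)))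
  · obtain ⟨h, hh⟩ := Φ.symm.exists_half_inl hT hΦ' h'
    exfalso
    rw [hx] at hh
    have : Φ.symm.half (Φ.half (halfSum E ET (.inr ⟨v, x⟩))) = halfSum E ET (.inr ⟨v, x⟩) :=
      Φ.half.symm_apply_apply _
    rw [this] at hh
    simp at hh
  · exact ⟨v', x', hx.symm⟩

/-- An isomorphism of assembled graphs which preserves roots comes from isomorphisms of the
parts. -/
theorem Iso.exists_of_assemble (hTc : ∀ v, (T v).Connected)
    (hT : ∀ v e, ¬ ((T v).ends e false = r v ∧ (T v).ends e true = r v))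
    (hT' : ∀ v e, ¬ ((T' v).ends e false = r' v ∧ (T' v).ends e true = r' v))
    (Φ : Iso (C.assemble T r) (C'.assemble T' r'))
    (hΦ : ∀ v, ∃ v', Φ.vert ⟨v, r v⟩ = ⟨v', r' v'⟩)
    (hΦ' : ∀ v', ∃ v, Φ.symm.vert ⟨v', r' v'⟩ = ⟨v, r v⟩) :
    ∃ (φ : Iso C C') (ψ : ∀ v, Iso (T v) (T' (φ.vert v)))
      (hψ : ∀ v, (ψ v).vert (r v) = r' (φ.vert v)), φ.assemble ψ hψ = Φ := by
  have hΦs (x) : Φ.vert (Φ.symm.vert x) = x := Φ.vert.apply_symm_apply x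
  have hΦs' (x) : Φ.half (Φ.symm.half x) = x := Φ.half.apply_symm_apply x
  choose f hf using hΦ
  choose p hp using Φ.exists_half_inl hT' (fun v => ⟨_, hf v⟩)
  have hfb : Function.Bijective f := by
    refine ⟨fun v w h => ?_, fun v' => ?_⟩
    · have := (hf v).trans ((by rw [h] : (⟨f v, r' (f v)⟩ : Σ v, VT' v) = _).trans (hf w).symm)
      exact congrArg Sigma.fst (Φ.vert.injective this)
    · obtain ⟨v, hv⟩ := hΦ' v'
      refine ⟨v, ?_⟩
      have := hf v
      rw [← hv, hΦs] at this
      exact (congrArg Sigma.fst this).symm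
  have hpb : Function.Bijective p := by
    refine ⟨fun v w h => ?_, fun h' => ?_⟩
    · have := (hp v).trans ((by rw [h] : halfSum E' ET' (.inl (p v)) = _).trans (hp w).symm)
      simpa using this
    · obtain ⟨h, hh⟩ := Φ.symm.exists_half_inl hT hΦ' h'
      refine ⟨h, ?_⟩
      have := hp h
      rw [← hh, hΦs'] at this
      simpa using this.symm
  let φ : Iso C C' :=
    { vert := Equiv.ofBijective f hfb
      half := Equiv.ofBijective p hpb
      half_flip := fun h => by
        have := Φ.half_flip (halfSum E ET (.inl h))
        rw [flipHalf_halfSum_inl, hp, hp, flipHalf_halfSum_inl] at this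
        simpa using this
      attach_half := fun h => by
        have := Φ.attach_half (halfSum E ET (.inl h))
        rw [hp, attach_assemble_inl, attach_assemble_inl, hf] at this
        exact congrArg Sigma.fst this }
  have hfib (v : V) (u : VT v) : (Φ.vert ⟨v, u⟩).1 = f v := by
    have := (T v).rel_of_reachable
      (R := fun x y => (Φ.vert ⟨v, x⟩).1 = (Φ.vert ⟨v, y⟩).1) (fun _ => rfl)
      (fun _ _ _ h h' => h.trans h') (fun h => ?_) ((hTc v).reachable u (r v))
    · rw [this, hf]
    · obtain ⟨v', x', hx⟩ := Φ.exists_half_inr hT hΦ' v h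
      have h1 := Φ.attach_half (halfSum E ET (.inr ⟨v, h⟩))
      have h2 := Φ.attach_flip_half (halfSum E ET (.inr ⟨v, h⟩))
      rw [hx, attach_assemble_inr, attach_assemble_inr] at h1
      rw [hx, flipHalf_halfSum_inr, flipHalf_halfSum_inr, attach_assemble_inr,
        attach_assemble_inr] at h2
      rw [← h1, ← h2]
  have hvex (v : V) (u : VT v) : ∃ u', Φ.vert ⟨v, u⟩ = ⟨f v, u'⟩ := by
    have := hfib v u
    generalize Φ.vert ⟨v, u⟩ = y at this
    obtain ⟨a, u'⟩ := y
    dsimp only at this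
    subst this
    exact ⟨u', rfl⟩
  have hhex (v : V) (x : ET v × Bool) :
      ∃ x', Φ.half (halfSum E ET (.inr ⟨v, x⟩)) = halfSum E' ET' (.inr ⟨f v, x'⟩) := by
    obtain ⟨v', x', hx⟩ := Φ.exists_half_inr hT hΦ' v x
    have h1 := Φ.attach_half (halfSum E ET (.inr ⟨v, x⟩))
    rw [hx, attach_assemble_inr, attach_assemble_inr] at h1
    obtain rfl : v' = f v := (congrArg Sigma.fst h1).trans (hfib _ _)
    exact ⟨x', hx⟩
  choose a ha using hvex
  choose b hb using hhex
  have hab (v : V) : Function.Bijective (a v) := by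
    refine ⟨fun x y h => ?_, fun u' => ?_⟩
    · have := (ha v x).trans ((by rw [h] : (⟨f v, a v x⟩ : Σ v, VT' v) = _).trans (ha v y).symm)
      exact eq_of_heq (Sigma.mk.inj_iff.1 (Φ.vert.injective this)).2
    · obtain ⟨⟨w, u⟩, hu⟩ := Φ.vert.surjective ⟨f v, u'⟩
      obtain rfl : w = v := hfb.1 ((hfib w u).symm.trans (congrArg Sigma.fst hu))
      rw [ha] at hu
      exact ⟨u, eq_of_heq (Sigma.mk.inj_iff.1 hu).2⟩
  have hbb (v : V) : Function.Bijective (b v) := by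
    refine ⟨fun x y h => ?_, fun x' => ?_⟩
    · have := (hb v x).trans
        ((by rw [h] : halfSum E' ET' (.inr ⟨f v, b v x⟩) = _).trans (hb v y).symm)
      simpa using this
    · obtain ⟨y, hy⟩ := Φ.half.surjective (halfSum E' ET' (.inr ⟨f v, x'⟩))
      obtain ⟨h | ⟨w, x⟩, rfl⟩ := (halfSum E ET).surjective y
      · rw [hp] at hy
        simp at hy
      · rw [hb] at hy
        have hy' := Sum.inr.inj ((halfSum E' ET').injective hy)
        obtain rfl : w = v := hfb.1 (congrArg Sigma.fst hy')
        exact ⟨x, eq_of_heq (Sigma.mk.inj_iff.1 hy').2⟩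
  let ψ (v : V) : Iso (T v) (T' (φ.vert v)) :=
    { vert := Equiv.ofBijective (a v) (hab v)
      half := Equiv.ofBijective (b v) (hbb v)
      half_flip := fun x => by
        have := Φ.half_flip (halfSum E ET (.inr ⟨v, x⟩))
        rw [flipHalf_halfSum_inr, hb, hb, flipHalf_halfSum_inr] at this
        exact eq_of_heq (Sigma.mk.inj_iff.1 (Sum.inr.inj ((halfSum E' ET').injective this))).2
      attach_half := fun x => by
        have := Φ.attach_half (halfSum E ET (.inr ⟨v, x⟩))
        rw [hb, attach_assemble_inr, attach_assemble_inr, ha] at this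
        exact eq_of_heq (Sigma.mk.inj_iff.1 this).2 }
  refine ⟨φ, ψ, fun v => ?_, ?_⟩
  · have := ha v (r v)
    rw [hf] at this
    exact (eq_of_heq (Sigma.mk.inj_iff.1 this).2).symm
  · refine Iso.ext ?_ fun x => ?_
    · rintro ⟨v, u⟩
      exact (ha v u).symm
    · obtain ⟨h | ⟨v, h⟩, rfl⟩ := (halfSum E ET).surjective x
      · exact (hp h).symm
      · exact (hb v h).symm

/-- The heterogeneous equality is needed because the targets of the tree isomorphisms depend on `φ`.
-/
theorem Iso.assemble_injective {φ φ' : Iso C C'} {ψ : ∀ v, Iso (T v) (T' (φ.vert v))}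
    {ψ' : ∀ v, Iso (T v) (T' (φ'.vert v))} {hψ : ∀ v, (ψ v).vert (r v) = r' (φ.vert v)}
    {hψ' : ∀ v, (ψ' v).vert (r v) = r' (φ'.vert v)}
    (h : φ.assemble ψ hψ = φ'.assemble ψ' hψ') : φ = φ' ∧ HEq ψ ψ' := by
  obtain rfl : φ = φ' := by
    refine Iso.ext (fun v => ?_) fun x => ?_
    · exact congrArg (fun Φ => (Φ.vert ⟨v, r v⟩).1) h
    · have := congrArg (fun Φ => Φ.half (halfSum E ET (.inl x))) h
      rw [assemble_half_inl, assemble_half_inl] at this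
      simpa using this
  refine ⟨rfl, heq_of_eq (funext fun v => Iso.ext (fun u => ?_) fun x => ?_)⟩
  · have := congrArg (fun Φ => Φ.vert ⟨v, u⟩) h
    rw [assemble_vert, assemble_vert] at this
    exact eq_of_heq (Sigma.mk.inj_iff.1 this).2
  · have := congrArg (fun Φ => Φ.half (halfSum E ET (.inr ⟨v, x⟩))) h
    rw [assemble_half_inr, assemble_half_inr] at this
    exact eq_of_heq (Sigma.mk.inj_iff.1 (Sum.inr.inj ((halfSum E' ET').injective this))).2

theorem ends_ne_of_loopNumber_eq_zero [Finite E] {G : Multigraph V E} (hG : G.loopNumber = 0)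
    (v : V) (e : E) : ¬ (G.ends e false = v ∧ G.ends e true = v) := by
  rintro ⟨h1, h2⟩
  have h3 : LinearMap.ker G.boundary = ⊥ := Submodule.finrank_eq_zero.1 hG
  have h4 : Finsupp.single e (1 : ℤ) ∈ LinearMap.ker G.boundary := by
    rw [LinearMap.mem_ker]
    simp [boundary, h1, h2]
  rw [h3, Submodule.mem_bot] at h4
  simp at h4

/-- Isomorphisms between graphs assembled from trees. -/
theorem card_iso_assemble [Finite V] [Finite V'] [Fintype (Iso C C')] [Fintype V] [Finite E]
    [Finite E'] [∀ v, Fintype (VT v)] [∀ v, Fintype (ET v)] [∀ v, Fintype (VT' v)]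
    [∀ v, Fintype (ET' v)] (hC : ∀ v, 2 ≤ C.degree v) (hC' : ∀ v, 2 ≤ C'.degree v)
    (hT : ∀ v, (T v).Connected) (hT' : ∀ v, (T' v).Connected)
    (hT0 : ∀ v, (T v).loopNumber = 0) (hT0' : ∀ v, (T' v).loopNumber = 0) :
    Nat.card (Iso (C.assemble T r) (C'.assemble T' r')) =
      ∑ φ : Iso C C', ∏ v, Nat.card {ψ : Iso (T v) (T' (φ.vert v)) // ψ.vert (r v) = r' _} := by
  have h1 := core_assemble r hC hT hT0
  have h2 := core_assemble r' hC' hT' hT0'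
  rw [← Finset.sum_congr rfl fun φ _ => Nat.card_pi, ← Nat.card_sigma]
  refine (Nat.card_congr (Equiv.ofBijective (fun x : Σ φ : Iso C C', ∀ v,
    {ψ : Iso (T v) (T' (φ.vert v)) // ψ.vert (r v) = r' _} =>
      x.1.assemble (fun v => (x.2 v).1) (fun v => (x.2 v).2)) ⟨?_, fun Φ => ?_⟩)).symm
  · rintro ⟨φ, x⟩ ⟨φ', x'⟩ h
    obtain ⟨rfl, h⟩ := Iso.assemble_injective h
    congr 1
    funext v
    exact Subtype.ext (congrFun (eq_of_heq h) v)
  · obtain ⟨φ, ψ, hψ, rfl⟩ := Φ.exists_of_assemble hT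
      (fun v e => ends_ne_of_loopNumber_eq_zero (hT0 v) _ e)
      (fun v e => ends_ne_of_loopNumber_eq_zero (hT0' v) _ e)
      (fun v => by
        have := Φ.map_mem_core (h1 ▸ ⟨v, rfl⟩ : (⟨v, r v⟩ : Σ v, VT v) ∈ _)
        rw [h2] at this
        obtain ⟨v', hv'⟩ := this
        exact ⟨v', hv'.symm⟩)
      (fun v => by
        have := Φ.symm.map_mem_core (h2 ▸ ⟨v, rfl⟩ : (⟨v, r' v⟩ : Σ v, VT' v) ∈ _)
        rw [h1] at this
        obtain ⟨v', hv'⟩ := this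
        exact ⟨v', hv'.symm⟩)
    exact ⟨⟨φ, fun v => ⟨ψ v, hψ v⟩⟩, rfl⟩

end Assemble

/-! ### Decomposition of a graph into its core and trees. -/

theorem two_le_degree_of_ne {V E : Type*} [Finite E] {G : Multigraph V E} {v : V}
    {h₁ h₂ : E × Bool} (h : h₁ ≠ h₂) (h1 : G.attach h₁ = v) (h2 : G.attach h₂ = v) :
    2 ≤ G.degree v := by
  refine Finite.one_lt_card_iff_nontrivial.2 ⟨⟨h₁, h1⟩, ⟨h₂, h2⟩, fun h' => h ?_⟩
  exact congrArg Subtype.val h'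

/-- A connected graph with a cycle has a nonempty core. -/
theorem core_nonempty {V E : Type*} [Fintype V] [Fintype E] {G : Multigraph V E}
    (hG : G.Connected) (hl : 1 ≤ G.loopNumber) : G.core.Nonempty := by
  classical
  let edgesIn (U : Finset V) : Finset E :=
    Finset.univ.filter fun e => G.ends e false ∈ U ∧ G.ends e true ∈ U
  have hmem (U : Finset V) (e : E) : e ∈ edgesIn U ↔ G.ends e false ∈ U ∧ G.ends e true ∈ U := by
    simp [edgesIn]
  have hne := hG.nonempty'
  -- A smallest nonempty set inducing at least as many edges as it has vertices. All vertices
  -- together qualify by Euler's formula. A vertex with at most one half-edge staying in `U` could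
  -- be removed, at the cost of at most one edge.
  obtain ⟨U, hU, hmin⟩ := Finset.exists_min_image
    (Finset.univ.filter fun U : Finset V => U.Nonempty ∧ U.card ≤ (edgesIn U).card) Finset.card
    ⟨Finset.univ, by
      have := hG.loopNumber_add_card
      simp [edgesIn]
      omega⟩
  rw [Finset.mem_filter] at hU
  obtain ⟨-, ⟨v₀, hv₀⟩, hcard⟩ := hU
  refine ⟨v₀, (U : Set V), fun v hv => ?_, hv₀⟩
  by_contra hcon
  push Not at hcon
  have hv : v ∈ U := hv
  let P : Finset (E × Bool) :=
    Finset.univ.filter fun h => G.attach h = v ∧ G.attach (flipHalf h) ∈ U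
  have hP : P.card ≤ 1 := by
    refine Finset.card_le_one.2 fun h₁ h1 h₂ h2 => ?_
    simp only [P, Finset.mem_filter, Finset.mem_univ, true_and] at h1 h2
    by_contra h
    exact hcon h₁ h₂ h h1.1 h2.1 h1.2 h2.2
  have hsub : edgesIn U ⊆ edgesIn (U.erase v) ∪ P.image Prod.fst := by
    intro e he
    rw [hmem] at he
    rw [Finset.mem_union, hmem, Finset.mem_image]
    by_cases h1 : G.ends e false = v
    · exact Or.inr ⟨(e, false), Finset.mem_filter.2 ⟨Finset.mem_univ _, h1, he.2⟩, rfl⟩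
    by_cases h2 : G.ends e true = v
    · exact Or.inr ⟨(e, true), Finset.mem_filter.2 ⟨Finset.mem_univ _, h2, he.1⟩, rfl⟩
    exact Or.inl ⟨Finset.mem_erase.2 ⟨h1, he.1⟩, Finset.mem_erase.2 ⟨h2, he.2⟩⟩
  have h1 := Finset.card_le_card hsub
  have h2 := Finset.card_union_le (edgesIn (U.erase v)) (P.image Prod.fst)
  have h3 : (P.image Prod.fst).card ≤ P.card := Finset.card_image_le
  have h4 := Finset.card_erase_of_mem hv
  have h5 : 0 < U.card := Finset.card_pos.2 ⟨v, hv⟩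
  -- If nothing remains, `U` is a single vertex with a loop, and the loop supplies two distinct
  -- half-edges.
  rcases (U.erase v).eq_empty_or_nonempty with h | h
  · have hUv (w : V) (hw : w ∈ U) : w = v := by
      by_contra hwv
      have := Finset.mem_erase.2 ⟨hwv, hw⟩
      rw [h] at this
      simp at this
    obtain ⟨e, he⟩ : (edgesIn U).Nonempty := Finset.card_pos.1 (by omega)
    rw [hmem] at he
    exact hcon (e, false) (e, true) (by simp) (hUv _ he.1) (hUv _ he.2) he.2 he.1
  · have := hmin (U.erase v) (Finset.mem_filter.2 ⟨Finset.mem_univ _, h, by omega⟩)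
    omega

/-- A connected graph with a cycle is obtained by attaching trees to the vertices of a connected
graph with all degrees at least `2`. -/
theorem exists_iso_assemble {V E : Type} [Fintype V] [Fintype E] {H : Multigraph V E}
    (hH : H.Connected) (hl : 1 ≤ H.loopNumber) :
    ∃ (V₀ E₀ : Type) (_ : Fintype V₀) (_ : Fintype E₀) (C : Multigraph V₀ E₀)
      (VT ET : V₀ → Type) (_ : ∀ v, Fintype (VT v)) (_ : ∀ v, Fintype (ET v))
      (T : ∀ v, Multigraph (VT v) (ET v)) (r : ∀ v, VT v),
      C.Connected ∧ C.loopNumber = H.loopNumber ∧ (∀ v, 2 ≤ C.degree v) ∧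
      (∀ v, (T v).Connected) ∧ (∀ v, (T v).loopNumber = 0) ∧
      Nonempty (Iso H (C.assemble T r)) := by
  classical
  set S := H.core with hS
  obtain ⟨d, p, hp, hd⟩ := hH.exists_parent (core_nonempty hH hl)
  have hinj := H.parentEdge_injective hp hd
  let par (u : V) : V := if h : u ∈ S then u else H.attach (flipHalf (p ⟨u, h⟩))
  have par_of_mem {u : V} (h : u ∈ S) : par u = u := dif_pos h
  have par_of_notMem {u : V} (h : u ∉ S) : par u = H.attach (flipHalf (p ⟨u, h⟩)) := dif_neg h
  have hdpar {u : V} (h : u ∉ S) : d (par u) < d u := by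
    rw [par_of_notMem h]
    exact hd ⟨u, h⟩
  have iter_mem (n : ℕ) : ∀ u, d u ≤ n → par^[n] u ∈ S := by
    induction n with
    | zero =>
      intro u hu
      change u ∈ S
      by_contra h
      have := hdpar h
      omega
    | succ n ih =>
      intro u hu
      by_cases h : u ∈ S
      · rw [Function.iterate_fixed (par_of_mem h)]
        exact h
      · rw [Function.iterate_succ_apply]
        have := hdpar h
        exact ih _ (by omega)
  obtain ⟨N, hN⟩ : ∃ N, ∀ u, d u ≤ N :=
    ⟨∑ u, d u, fun u => Finset.single_le_sum (fun _ _ => Nat.zero_le _) (Finset.mem_univ u)⟩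
  -- Since `N` bounds all ranks, following parents `N` times ends in the core: `ρ u` is the root of
  -- the tree containing `u`.
  let ρ (u : V) : V := par^[N] u
  have ρ_mem (u : V) : ρ u ∈ S := iter_mem N u (hN u)
  have ρ_of_mem {u : V} (h : u ∈ S) : ρ u = u := Function.iterate_fixed (par_of_mem h) N
  have ρ_par (u : V) : ρ (par u) = ρ u := by
    have : par (ρ u) = ρ u := par_of_mem (ρ_mem u)
    change par^[N] (par u) = _
    rw [← Function.iterate_succ_apply, Function.iterate_succ_apply']
    exact this
  -- Otherwise the core together with the parent paths from both ends of `e` would be dense: each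
  -- new vertex has its parent half-edge and either `e` or the half-edge by which the path arrives.
  -- Both ends of `e` would then lie in the core.
  have hedge (e : E) (he : ¬ (H.ends e false ∈ S ∧ H.ends e true ∈ S)) : ∃ u, (p u).1 = e := by
    by_contra hcon
    push Not at hcon
    let U : Set V := S ∪ {w | ∃ b n, par^[n] (H.ends e b) = w}
    have hU : H.IsDense U := by
      intro w hw
      by_cases hwS : w ∈ S
      · obtain ⟨h₁, h₂, h0, h1, h2, h3, h4⟩ := H.isDense_core w hwS
        exact ⟨h₁, h₂, h0, h1, h2, Or.inl h3, Or.inl h4⟩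
      obtain ⟨b, n, hn⟩ := hw.resolve_left hwS
      have hflip : H.attach (flipHalf (p ⟨w, hwS⟩)) ∈ U := by
        rw [← par_of_notMem hwS]
        exact Or.inr ⟨b, n + 1, by rw [Function.iterate_succ_apply', hn]⟩
      cases n with
      | zero =>
        refine ⟨p ⟨w, hwS⟩, (e, b), fun h => hcon _ (congrArg Prod.fst h), hp _, hn, hflip, ?_⟩
        exact Or.inr ⟨!b, 0, rfl⟩
      | succ m =>
        rw [Function.iterate_succ_apply'] at hn
        have hy : par^[m] (H.ends e b) ∉ S := fun h => by
          rw [par_of_mem h] at hn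
          exact hwS (hn ▸ h)
        refine ⟨p ⟨w, hwS⟩, flipHalf (p ⟨_, hy⟩), fun h => ?_, hp _, ?_, hflip, ?_⟩
        · have h' : w = par^[m] (H.ends e b) := Subtype.mk.inj (hinj (congrArg Prod.fst h :
            (p ⟨w, hwS⟩).1 = (flipHalf (p ⟨_, hy⟩)).1))
          have := hdpar hy
          rw [hn, ← h'] at this
          exact lt_irrefl _ this
        · rw [← par_of_notMem hy, hn]
        · rw [flipHalf_flipHalf, hp]
          exact Or.inr ⟨b, m, rfl⟩
    exact he ⟨hU.subset_core (Or.inr ⟨false, 0, rfl⟩), hU.subset_core (Or.inr ⟨true, 0, rfl⟩)⟩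
  have hρp (u) : ρ (H.attach (flipHalf (p u))) = ρ u := by
    rw [← ρ_par u.1, par_of_notMem u.2]
  have hρe (e : E) (he : ¬ (H.ends e false ∈ S ∧ H.ends e true ∈ S)) (b : Bool) :
      ρ (H.ends e b) = ρ (H.ends e false) := by
    obtain ⟨u, rfl⟩ := hedge e he
    have h1 := hρp u
    have h2 := congrArg ρ (hp u)
    generalize p u = h at h1 h2 ⊢
    obtain ⟨e, c⟩ := h
    simp only [attach, flipHalf] at h1 h2
    cases b <;> cases c <;> simp_all
  have hpS (u) : ¬ (H.ends (p u).1 false ∈ S ∧ H.ends (p u).1 true ∈ S) := by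
    have h1 := hp u
    have h2 := u.2
    generalize p u = h at h1
    obtain ⟨e, c⟩ := h
    rw [← h1] at h2
    simp only [attach] at h2
    cases c <;> tauto
  let C : Multigraph {v // v ∈ S} {e // H.ends e false ∈ S ∧ H.ends e true ∈ S} :=
    { ends := fun e b => ⟨H.ends e.1 b, by cases b; exacts [e.2.1, e.2.2]⟩ }
  let T (v : {v // v ∈ S}) : Multigraph {u // ρ u = v}
      {e // ¬ (H.ends e false ∈ S ∧ H.ends e true ∈ S) ∧ ρ (H.ends e false) = v} :=
    { ends := fun e b => ⟨H.ends e.1 b, (hρe _ e.2.1 b).trans e.2.2⟩ }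
  let r (v : {v // v ∈ S}) : {u // ρ u = v} := ⟨v, ρ_of_mem v.2⟩
  have hcoreEdge {h : E × Bool} (h1 : H.attach h ∈ S) (h2 : H.attach (flipHalf h) ∈ S) :
      H.ends h.1 false ∈ S ∧ H.ends h.1 true ∈ S := by
    obtain ⟨e, b⟩ := h
    cases b
    exacts [⟨h1, h2⟩, ⟨h2, h1⟩]
  have hC : C.Connected := by
    refine hH.map (fun u => (⟨ρ u, ρ_mem u⟩ : {v // v ∈ S})) (fun h => ?_)
      fun v => ⟨v, by
        have : (⟨ρ v, ρ_mem v⟩ : {v // v ∈ S}) = v := Subtype.ext (ρ_of_mem v.2)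
        rw [this]⟩
    by_cases he : H.ends h.1 false ∈ S ∧ H.ends h.1 true ∈ S
    · have hh (b : Bool) : H.ends h.1 b ∈ S := by cases b; exacts [he.1, he.2]
      have := C.reachable_attach (⟨h.1, he⟩, h.2)
      convert this using 1
      · exact Subtype.ext (ρ_of_mem (hh _))
      · exact Subtype.ext (ρ_of_mem (hh _))
    · have : ρ (H.attach h) = ρ (H.attach (flipHalf h)) :=
        (hρe h.1 he _).trans (hρe h.1 he _).symm
      simp only [this]
      rfl
  have hdeg (v) : 2 ≤ C.degree v := by
    obtain ⟨h₁, h₂, h0, h1, h2, h3, h4⟩ := H.isDense_core v.1 v.2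
    refine two_le_degree_of_ne (h₁ := (⟨h₁.1, hcoreEdge (h1 ▸ v.2) h3⟩, h₁.2))
      (h₂ := (⟨h₂.1, hcoreEdge (h2 ▸ v.2) h4⟩, h₂.2)) (fun h => h0 ?_)
      (Subtype.ext h1) (Subtype.ext h2)
    simp only [Prod.mk.injEq, Subtype.mk.injEq] at h
    exact Prod.ext h.1 h.2
  have hpT (v : {v // v ∈ S}) (u) (hu : ρ u.1 = v) :
      ¬ (H.ends (p u).1 false ∈ S ∧ H.ends (p u).1 true ∈ S) ∧
        ρ (H.ends (p u).1 false) = v := by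
    refine ⟨hpS u, ?_⟩
    rw [← hρe _ (hpS u) (p u).2, ← hu]
    exact congrArg ρ (hp u)
  have hT (v) : (T v).Connected := by
    have key (n : ℕ) : ∀ u : {u // ρ u = v}, d u.1 = n →
        (T v).toSimpleGraph.Reachable u (r v) := by
      induction n using Nat.strong_induction_on with
      | _ n ih =>
        intro u hn
        by_cases hu : u.1 ∈ S
        · have : u = r v := Subtype.ext (by rw [← ρ_of_mem hu, u.2])
          rw [this]
        · have h1 := (T v).reachable_attach (⟨(p ⟨u, hu⟩).1, hpT v ⟨u, hu⟩ u.2⟩, (p ⟨u, hu⟩).2)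
          have h2 : (T v).attach (⟨(p ⟨u, hu⟩).1, hpT v ⟨u, hu⟩ u.2⟩, (p ⟨u, hu⟩).2) = u :=
            Subtype.ext (hp ⟨u, hu⟩)
          rw [h2] at h1
          exact h1.trans (ih _ (hn ▸ hd ⟨u, hu⟩) _ rfl)
    rw [connected_iff]
    exact ⟨⟨r v⟩, fun u w => (key _ u rfl).trans (key _ w rfl).symm⟩
  have hnotMem {v : {v // v ∈ S}} (u : {u : {u // ρ u = v} // u ≠ r v}) : u.1.1 ∉ S := fun h =>
    u.2 (Subtype.ext (by rw [← ρ_of_mem h, u.1.2]))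
  have hT0 (v) : (T v).loopNumber = 0 := by
    have h1 := (hT v).loopNumber_add_card
    -- Parent edges match the non-root vertices with the edges of the tree, so Euler's formula gives
    -- loop number 0.
    have h2 : Fintype.card {u : {u // ρ u = v} // u ≠ r v} =
        Fintype.card {e // ¬ (H.ends e false ∈ S ∧ H.ends e true ∈ S) ∧
          ρ (H.ends e false) = v} := by
      refine Fintype.card_congr (Equiv.ofBijective
        (fun u => ⟨(p ⟨u.1.1, hnotMem u⟩).1, hpT v ⟨u.1.1, hnotMem u⟩ u.1.2⟩) ⟨?_, ?_⟩)
      · intro u w h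
        have := hinj (congrArg Subtype.val h)
        exact Subtype.ext (Subtype.ext (Subtype.mk.inj this))
      · rintro ⟨e, he, hev⟩
        obtain ⟨u, rfl⟩ := hedge e he
        have hu : ρ u.1 = v := by
          rw [← hev, ← hρe _ he (p u).2]
          exact congrArg ρ (hp u).symm
        exact ⟨⟨⟨u.1, hu⟩, fun h => u.2 (congrArg Subtype.val h ▸ v.2)⟩, rfl⟩
    have h3 := Fintype.card_subtype_compl (fun u => u = r v)
    rw [Fintype.card_subtype_eq] at h3
    have h4 : 0 < Fintype.card {u // ρ u = v} := Fintype.card_pos_iff.2 ⟨r v⟩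
    have h5 : Fintype.card {u : {u // ρ u = v} // u ≠ r v} = Fintype.card {u // ¬ u = r v} := rfl
    omega
  have hvert : Function.Bijective fun x : Σ v : {v // v ∈ S}, {u // ρ u = v} => x.2.1 := by
    constructor
    · rintro ⟨⟨v, hv⟩, u, hu⟩ ⟨⟨w, hw⟩, u', hu'⟩ h
      dsimp only at h hu hu'
      subst h
      obtain rfl : v = w := hu.symm.trans hu'
      rfl
    · intro u
      exact ⟨⟨⟨ρ u, ρ_mem u⟩, ⟨u, rfl⟩⟩, rfl⟩
  let f : ({e // H.ends e false ∈ S ∧ H.ends e true ∈ S} ⊕ Σ v : {v // v ∈ S},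
      {e // ¬ (H.ends e false ∈ S ∧ H.ends e true ∈ S) ∧ ρ (H.ends e false) = v}) → E :=
    Sum.elim (fun e => e.1) fun x => x.2.1
  have hf : Function.Bijective f := by
    constructor
    · rintro (⟨e, he⟩ | ⟨⟨v, hv⟩, e, he, hev⟩) (⟨e', he'⟩ | ⟨⟨w, hw⟩, e', he', hew⟩) h <;>
        simp only [f, Sum.elim_inl, Sum.elim_inr] at h <;> subst h
      · rfl
      · exact absurd he he'
      · exact absurd he' he
      · dsimp only at hev hew
        obtain rfl : v = w := hev.symm.trans hew
        rfl
    · intro e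
      by_cases he : H.ends e false ∈ S ∧ H.ends e true ∈ S
      · exact ⟨.inl ⟨e, he⟩, rfl⟩
      · exact ⟨.inr ⟨⟨ρ (H.ends e false), ρ_mem _⟩, ⟨e, he, rfl⟩⟩, rfl⟩
  let φ : Iso (C.assemble T r) H :=
    Iso.ofEdges (Equiv.ofBijective _ hvert) (Equiv.ofBijective f hf) (by
      rintro (e | ⟨v, e⟩) b <;> rfl)
  refine ⟨_, _, inferInstance, inferInstance, C, _, _, fun _ => inferInstance,
    fun _ => inferInstance, T, r, hC, ?_, hdeg, hT, hT0, ⟨φ.symm⟩⟩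
  rw [← φ.symm.loopNumber_eq hH, loopNumber_assemble r hC hT hT0]

/-! ### Colourings of assembled graphs. -/

variable {V E : Type*}

theorem kind_eq_black_iff (G : Multigraph V E) (c : V → ZMod 2) (v : V) :
    G.kind c v = .black ↔ c v = 1 := by
  unfold kind
  by_cases h : c v = 1
  · simp [h]
  · rw [if_neg h]
    simp only [h, iff_false]
    split <;> simp

theorem kind_eq_whiteEven_iff (G : Multigraph V E) (c : V → ZMod 2) (v : V) :
    G.kind c v = .whiteEven ↔ c v ≠ 1 ∧ Even (G.blackNeighbors c v) := by
  unfold kind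
  by_cases h : c v = 1
  · simp [h]
  · rw [if_neg h]
    by_cases h' : Even (G.blackNeighbors c v) <;> simp [h, h']

theorem kind_eq_whiteOdd_iff (G : Multigraph V E) (c : V → ZMod 2) (v : V) :
    G.kind c v = .whiteOdd ↔ c v ≠ 1 ∧ ¬ Even (G.blackNeighbors c v) := by
  unfold kind
  by_cases h : c v = 1
  · simp [h]
  · rw [if_neg h]
    by_cases h' : Even (G.blackNeighbors c v) <;> simp [h, h']

/-- The factor contributed by a vertex of kind `κ` in a graph, after attaching a tree in which the
root has kind `κ'`. -/
noncomputable def rootFactor : VertexKind → VertexKind → Polynomial ℤ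
  | .black, _ => 1
  | .whiteEven, κ' => if κ' = .whiteOdd then 1 else Polynomial.X
  | .whiteOdd, κ' => if κ' = .whiteOdd then Polynomial.X else 1

open Classical in
/-- The contribution of a coloured rooted graph attached to a vertex of kind `κ`. -/
noncomputable def attachedMonomial [Fintype V] (T : Multigraph V E) (r : V) (κ : VertexKind)
    (c : V → ZMod 2) : Polynomial ℤ :=
  rootFactor κ (T.kind c r) *
    ∏ u ∈ Finset.univ.erase r, if T.kind c u = .whiteEven then Polynomial.X else 1

open Classical in
/-- The contribution of a rooted graph attached to a vertex of kind `κ`. -/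
noncomputable def attachedW [Fintype V] (T : Multigraph V E) (r : V) (κ : VertexKind) :
    Polynomial ℤ :=
  ∑ c : V → ZMod 2, if c r = 1 ↔ κ = .black then T.attachedMonomial r κ c else 0

open Classical in
/-- The contribution of the colourings for which the root has kind `κ`. -/
noncomputable def rootedW [Fintype V] (T : Multigraph V E) (r : V) (κ : VertexKind) :
    Polynomial ℤ :=
  ∑ c : V → ZMod 2, if T.kind c r = κ then T.coloringMonomial c else 0

theorem coloringMonomial_eq [Fintype V] [DecidableEq V] (T : Multigraph V E) (r : V)
    (c : V → ZMod 2) : T.coloringMonomial c = (if T.kind c r = .whiteEven then Polynomial.X else 1) *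
      ∏ u ∈ Finset.univ.erase r, if T.kind c u = .whiteEven then Polynomial.X else 1 :=
  (Finset.mul_prod_erase _ _ (Finset.mem_univ r)).symm

theorem attachedW_black [Fintype V] (T : Multigraph V E) (r : V) :
    T.attachedW r .black = T.rootedW r .black := by
  classical
  unfold attachedW rootedW
  refine Finset.sum_congr rfl fun c _ => ?_
  have h := T.kind_eq_black_iff c r
  by_cases hc : T.kind c r = .black
  · simp [attachedMonomial, T.coloringMonomial_eq r, rootFactor, h.1 hc, hc]
  · simp [hc, mt h.2 hc]

theorem attachedW_whiteEven [Fintype V] (T : Multigraph V E) (r : V) :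
    T.attachedW r .whiteEven = T.rootedW r .whiteEven + T.rootedW r .whiteOdd := by
  classical
  unfold attachedW rootedW
  rw [← Finset.sum_add_distrib]
  refine Finset.sum_congr rfl fun c _ => ?_
  have h := T.kind_eq_black_iff c r
  simp only [← h, T.coloringMonomial_eq r]
  unfold attachedMonomial rootFactor
  generalize T.kind c r = κ
  cases κ <;> simp

/-- The polynomial form of `t⁻¹ 𝒯_w⁺ + t 𝒯_w⁻`, multiplied by `t` to avoid the inverse: an odd
contribution from outside interchanges the two white kinds of the root. -/
theorem X_mul_attachedW_whiteOdd [Fintype V] (T : Multigraph V E) (r : V) :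
    Polynomial.X * T.attachedW r .whiteOdd =
      T.rootedW r .whiteEven + Polynomial.X * (Polynomial.X * T.rootedW r .whiteOdd) := by
  classical
  unfold attachedW rootedW
  simp only [Finset.mul_sum]
  rw [← Finset.sum_add_distrib]
  refine Finset.sum_congr rfl fun c _ => ?_
  have h := T.kind_eq_black_iff c r
  simp only [← h, T.coloringMonomial_eq r]
  unfold attachedMonomial rootFactor
  generalize T.kind c r = κ
  cases κ <;> simp

section Assemble

variable {VT ET : V → Type*} (C : Multigraph V E) (T : ∀ v, Multigraph (VT v) (ET v))
  (r : ∀ v, VT v)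

open Classical in
theorem blackNeighbors_assemble [Fintype V] [Fintype E] [∀ v, Fintype (ET v)]
    (a : (Σ v, VT v) → ZMod 2) (v : V) (u : VT v) :
    (C.assemble T r).blackNeighbors a ⟨v, u⟩ =
      (if u = r v then C.blackNeighbors (fun v => a ⟨v, r v⟩) v else 0) +
        (T v).blackNeighbors (fun u => a ⟨v, u⟩) u := by
  unfold blackNeighbors
  simp only [Nat.card_eq_fintype_card, Fintype.card_subtype, Finset.card_filter]
  rw [← (halfSum E ET).sum_comp, Fintype.sum_sum_type, Fintype.sum_sigma]
  simp only [attach_assemble_inl, attach_assemble_inr, flipHalf_halfSum_inl, flipHalf_halfSum_inr]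
  congr 1
  · split_ifs with h
    · subst h
      refine Finset.sum_congr rfl fun h _ => ?_
      have : (⟨C.attach h, r (C.attach h)⟩ : Σ v, VT v) = ⟨v, r v⟩ ↔ C.attach h = v :=
        ⟨fun h => congrArg Sigma.fst h, fun h => by rw [h]⟩
      simp only [this]
    · refine Finset.sum_eq_zero fun x _ => if_neg fun hx => h ?_
      obtain ⟨rfl, h'⟩ := Sigma.mk.inj_iff.1 hx.1
      exact (eq_of_heq h').symm
  · rw [Finset.sum_eq_single v]
    · simp
    · intro w _ hw
      refine Finset.sum_eq_zero fun x _ => if_neg fun hx => hw ?_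
      exact congrArg Sigma.fst hx.1
    · simp

theorem kind_assemble_of_ne [Fintype V] [Fintype E] [∀ v, Fintype (ET v)]
    (a : (Σ v, VT v) → ZMod 2) (v : V) {u : VT v} (hu : u ≠ r v) :
    (C.assemble T r).kind a ⟨v, u⟩ = (T v).kind (fun u => a ⟨v, u⟩) u := by
  unfold kind
  rw [blackNeighbors_assemble, if_neg hu, zero_add]

/-- Black neighbours in the core and in the tree add up, so only the two parities matter. -/
theorem kind_assemble_root [Fintype V] [Fintype E] [∀ v, Fintype (ET v)]
    (a : (Σ v, VT v) → ZMod 2) (v : V) :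
    (if (C.assemble T r).kind a ⟨v, r v⟩ = .whiteEven then Polynomial.X else 1) =
      rootFactor (C.kind (fun v => a ⟨v, r v⟩) v) ((T v).kind (fun u => a ⟨v, u⟩) (r v)) := by
  classical
  have h1 := blackNeighbors_assemble C T r a v (r v)
  rw [if_pos rfl] at h1
  have h2 := Nat.even_add (m := C.blackNeighbors (fun v => a ⟨v, r v⟩) v)
    (n := (T v).blackNeighbors (fun u => a ⟨v, u⟩) (r v))
  rw [← h1] at h2
  have h0 := kind_eq_whiteEven_iff (C.assemble T r) a ⟨v, r v⟩
  rw [h2] at h0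
  simp only [h0]
  by_cases hc : a ⟨v, r v⟩ = 1
  · rw [((C.kind_eq_black_iff _ _).2 hc :
      C.kind (fun v => a ⟨v, r v⟩) v = .black)]
    simp [hc, rootFactor]
  · have h3 := (T v).kind_eq_whiteOdd_iff (fun u => a ⟨v, u⟩) (r v)
    by_cases hC : Even (C.blackNeighbors (fun v => a ⟨v, r v⟩) v)
    · rw [((C.kind_eq_whiteEven_iff _ _).2 ⟨hc, hC⟩ :
        C.kind (fun v => a ⟨v, r v⟩) v = .whiteEven)]
      simp [hc, rootFactor, h3, hC, -Nat.not_even_iff_odd]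
    · rw [((C.kind_eq_whiteOdd_iff _ _).2 ⟨hc, hC⟩ :
        C.kind (fun v => a ⟨v, r v⟩) v = .whiteOdd)]
      simp [hc, rootFactor, h3, hC]

theorem coloringMonomial_assemble [Fintype V] [Fintype E] [∀ v, Fintype (VT v)]
    [∀ v, Fintype (ET v)] (a : (Σ v, VT v) → ZMod 2) :
    (C.assemble T r).coloringMonomial a =
      ∏ v, (T v).attachedMonomial (r v) (C.kind (fun v => a ⟨v, r v⟩) v) fun u => a ⟨v, u⟩ := by
  classical
  unfold coloringMonomial
  rw [Fintype.prod_sigma]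
  refine Finset.prod_congr rfl fun v _ => ?_
  rw [← Finset.mul_prod_erase _ _ (Finset.mem_univ (r v)), kind_assemble_root]
  unfold attachedMonomial
  congr 1
  refine Finset.prod_congr (by congr) fun u hu => ?_
  rw [kind_assemble_of_ne C T r a v (Finset.ne_of_mem_erase hu)]

/-- The black-white polynomial of an assembled graph. -/
theorem W_assemble [Fintype V] [Fintype E] [∀ v, Fintype (VT v)] [∀ v, Fintype (ET v)]
    [Fintype (V → ZMod 2)] :
    (C.assemble T r).W = ∑ c : V → ZMod 2, ∏ v, (T v).attachedW (r v) (C.kind c v) := by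
  classical
  trans ∑ a : (Σ v, VT v) → ZMod 2, (C.assemble T r).coloringMonomial a
  · unfold W
    congr!
  unfold attachedW
  simp_rw [Finset.prod_univ_sum, Fintype.piFinset_univ]
  rw [Finset.sum_comm]
  refine Fintype.sum_equiv (Equiv.piCurry fun _ _ => ZMod 2) _ _ fun a => ?_
  -- `attachedW` forces the root colours to agree with `c`, so only the restriction of `a` to the
  -- roots contributes.
  rw [coloringMonomial_assemble, Finset.sum_eq_single fun v => a ⟨v, r v⟩]
  · refine Finset.prod_congr rfl fun v _ => ?_
    rw [if_pos]
    · rfl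
    · exact (C.kind_eq_black_iff (fun v => a ⟨v, r v⟩) v).symm
  · intro c _ hc
    obtain ⟨v, hv⟩ := Function.ne_iff.1 hc
    refine Finset.prod_eq_zero (Finset.mem_univ v) (if_neg ?_)
    rw [kind_eq_black_iff]
    intro h
    apply hv
    change a ⟨v, r v⟩ = 1 ↔ c v = 1 at h
    generalize a ⟨v, r v⟩ = x at h ⊢
    generalize c v = y at h ⊢
    revert x y
    decide
  · simp

end Assemble

end Multigraph

/-! ### Tree series and the substituted series over `ℚ[t]`. -/

open Multigraph

/-- The series whose coefficients are weighted sums over rooted trees. -/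
noncomputable def treeSum (F : RootedTree → Polynomial ℤ) : PowerSeries (Polynomial ℚ) :=
  PowerSeries.mk fun n => ∑ᶠ q ∈ {q : RootedTreeClass | q.rep.order = n},
    (q.rep.graph.rootedAutCard q.rep.root : ℚ)⁻¹ • (F q.rep).map (Int.castRingHom ℚ)

theorem treeSeries_eq_treeSum (κ : VertexKind) :
    treeSeries κ = treeSum fun T => T.graph.rootedW T.root κ := by
  unfold treeSeries treeSum rootedW
  congr!

theorem coeff_treeSum (F : RootedTree → Polynomial ℤ) (n : ℕ) :
    PowerSeries.coeff n (treeSum F) = ∑ q ∈ (rootedTree_order_finite n).toFinset,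
      (q.rep.graph.rootedAutCard q.rep.root : ℚ)⁻¹ • (F q.rep).map (Int.castRingHom ℚ) := by
  unfold treeSum
  rw [PowerSeries.coeff_mk, finsum_mem_eq_finite_toFinset_sum _ (rootedTree_order_finite n)]

theorem treeSum_add (F G : RootedTree → Polynomial ℤ) :
    treeSum (fun T => F T + G T) = treeSum F + treeSum G := by
  ext1 n
  simp only [map_add, coeff_treeSum, Polynomial.map_add, smul_add, Finset.sum_add_distrib]

theorem treeSum_X_mul (F : RootedTree → Polynomial ℤ) :
    treeSum (fun T => Polynomial.X * F T) = PowerSeries.C Polynomial.X * treeSum F := by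
  ext1 n
  simp only [PowerSeries.coeff_C_mul, coeff_treeSum, Polynomial.map_mul, Polynomial.map_X,
    Finset.mul_sum, mul_smul_comm]

/-- The series in `ℚ[t]⟦x⟧` which is substituted for the variable of a vertex of kind `κ`. -/
noncomputable def attachedSeries (κ : VertexKind) : PowerSeries (Polynomial ℚ) :=
  treeSum fun T => T.graph.attachedW T.root κ

theorem toLaurentSeries_C_X_mul (f : PowerSeries (Polynomial ℚ)) :
    toLaurentSeries (PowerSeries.C Polynomial.X * f) =
      PowerSeries.C (LaurentPolynomial.T 1) * toLaurentSeries f := by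
  rw [map_mul]
  congr 1
  simp [toLaurentSeries, PowerSeries.map_C]

theorem C_T_mul_C_T (m n : ℤ) (f : PowerSeries (LaurentPolynomial ℚ)) :
    PowerSeries.C (LaurentPolynomial.T m) * (PowerSeries.C (LaurentPolynomial.T n) * f) =
      PowerSeries.C (LaurentPolynomial.T (m + n)) * f := by
  rw [← mul_assoc, ← map_mul, LaurentPolynomial.T_add]

/-- This is why the result has no negative powers of `t`. In the odd case the identity is proved
after multiplication by `t`, which is then cancelled in the Laurent polynomials. -/
theorem toLaurentSeries_attachedSeries (κ : VertexKind) :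
    toLaurentSeries (attachedSeries κ) = treeSubstitution κ := by
  unfold attachedSeries
  cases κ with
  | black => simp only [attachedW_black, treeSubstitution, treeSeries_eq_treeSum]
  | whiteEven =>
    simp only [attachedW_whiteEven, treeSubstitution, treeSeries_eq_treeSum, treeSum_add, map_add]
  | whiteOdd =>
    have h : PowerSeries.C (LaurentPolynomial.T 1) *
        toLaurentSeries (treeSum fun T => T.graph.attachedW T.root .whiteOdd) =
        PowerSeries.C (LaurentPolynomial.T 1) * treeSubstitution .whiteOdd := by
      rw [← toLaurentSeries_C_X_mul, ← treeSum_X_mul]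
      simp only [X_mul_attachedW_whiteOdd, treeSum_add, treeSum_X_mul, treeSubstitution, mul_add,
        treeSeries_eq_treeSum, map_add, toLaurentSeries_C_X_mul, C_T_mul_C_T, add_neg_cancel,
        LaurentPolynomial.T_zero, map_one, one_mul]
    have h2 := congrArg (PowerSeries.C (LaurentPolynomial.T (-1)) * ·) h
    simpa only [C_T_mul_C_T, neg_add_cancel, LaurentPolynomial.T_zero, map_one, one_mul] using h2

theorem constantCoeff_attachedSeries (κ : VertexKind) :
    PowerSeries.constantCoeff (attachedSeries κ) = 0 := by
  rw [← PowerSeries.coeff_zero_eq_constantCoeff_apply, attachedSeries, coeff_treeSum]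
  refine Finset.sum_eq_zero fun q hq => ?_
  have h := q.rep.root.isLt
  have hq' : q.rep.order = 0 := by simpa using hq
  omega

open Classical in
/-- The multidegree of the monomial of a colouring. -/
noncomputable def kindCount {V E : Type*} [Fintype V] (G : Multigraph V E) (c : V → ZMod 2) :
    VertexKind →₀ ℕ := ∑ v, Finsupp.single (G.kind c v) 1

theorem prod_kindCount {V E R : Type*} [Fintype V] [CommSemiring R] (G : Multigraph V E) (c : V → ZMod 2)
    (a : VertexKind → R) : ((kindCount G c).prod fun κ e => a κ ^ e) = ∏ v, a (G.kind c v) := by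
  unfold kindCount
  rw [← Finsupp.prod_finsetSum_index (fun _ => pow_zero _) fun _ _ _ => pow_add _ _ _]
  exact Finset.prod_congr rfl fun v _ =>
    (Finsupp.prod_single_index (h := fun κ e => a κ ^ e) (pow_zero _)).trans (pow_one _)

/-! ### Coefficients of the substitution. -/

section Substitution

variable {R : Type*} [CommRing R] [Algebra ℚ R]

open Classical in
theorem coeff_fullW {V E : Type*} [Fintype V] (G : Multigraph V E) (d : VertexKind →₀ ℕ) :
    G.fullW.coeff d = ∑ c : V → ZMod 2, if kindCount G c = d then 1 else 0 := by
  unfold fullW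
  rw [MvPolynomial.coeff_sum]
  refine Finset.sum_congr rfl fun c _ => ?_
  have : ∏ v, (MvPolynomial.X (G.kind c v) : MvPolynomial VertexKind ℤ) =
      MvPolynomial.monomial (kindCount G c) 1 := by
    unfold kindCount
    rw [MvPolynomial.monomial_sum_one]
    rfl
  rw [this, MvPolynomial.coeff_monomial]

open Classical in
/-- The coefficients of the substitution of series without constant term into the series of the
subdivisions of a graph. -/
theorem coeff_subst_subdivisionSeries {V E : Type*} [Fintype V] [Fintype E]
    (G : Multigraph V E) (a : VertexKind → PowerSeries R)
    (ha : ∀ κ, PowerSeries.constantCoeff (a κ) = 0) (n : ℕ) :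
    PowerSeries.coeff n (MvPowerSeries.subst a G.subdivisionSeries) =
      (G.autCard : ℚ)⁻¹ • ∑ k ∈ Fintype.piFinset fun _ : E => Finset.range (n + 1),
        ∑ c, PowerSeries.coeff n (∏ v, a ((G.subdivide k).kind c v)) := by
  -- Every substituted series is divisible by `x`, so monomials of degree above `n` do not reach `x
  -- ^ n`.
  have hdeg (d : VertexKind →₀ ℕ) (hd : n < d.degree) :
      PowerSeries.coeff n (d.prod fun κ e => a κ ^ e) = 0 := by
    have h : (PowerSeries.X : PowerSeries R) ^ d.degree ∣ d.prod fun κ e => a κ ^ e := by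
      rw [Finsupp.degree_apply, ← Finset.prod_pow_eq_pow_sum]
      exact Finset.prod_dvd_prod_of_dvd _ _ fun κ _ =>
        pow_dvd_pow_of_dvd (PowerSeries.X_dvd_iff.2 (ha κ)) _
    exact PowerSeries.X_pow_dvd_iff.1 h n hd
  have hfin : {d : VertexKind →₀ ℕ | d.degree ≤ n}.Finite := Finsupp.finite_of_degree_le n
  have h1 : PowerSeries.coeff n (MvPowerSeries.subst a G.subdivisionSeries) =
      ∑ d ∈ hfin.toFinset, MvPowerSeries.coeff d G.subdivisionSeries •
        PowerSeries.coeff n (d.prod fun κ e => a κ ^ e) := by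
    refine (MvPowerSeries.coeff_subst (MvPowerSeries.hasSubst_of_constantCoeff_zero ha) G.subdivisionSeries
      (Finsupp.single () n)).trans (finsum_eq_sum_of_support_subset _ fun d hd => ?_)
    rw [Set.Finite.coe_toFinset]
    by_contra hn
    refine hd ?_
    have := hdeg d (not_le.1 hn)
    change MvPowerSeries.coeff d G.subdivisionSeries • PowerSeries.coeff n _ = 0
    rw [this, smul_zero]
  -- A subdivision has `|V| + ∑ k e` vertices and its polynomial is homogeneous of that degree, so
  -- only `k e ≤ n` can contribute.
  have h2 (d) (hd : d ∈ hfin.toFinset) : MvPowerSeries.coeff d G.subdivisionSeries =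
      (G.autCard : ℚ)⁻¹ * ∑ k ∈ Fintype.piFinset fun _ : E => Finset.range (n + 1),
        (((G.subdivide k).fullW.coeff d : ℤ) : ℚ) := by
    change (G.autCard : ℚ)⁻¹ * ∑ᶠ k : E → ℕ, (((G.subdivide k).fullW.coeff d : ℤ) : ℚ) = _
    congr 1
    refine finsum_eq_sum_of_support_subset _ fun k hk => ?_
    have h0 : (G.subdivide k).fullW.coeff d ≠ 0 := by
      intro h
      simp [h] at hk
    have hd' : d.degree = Fintype.card V + ∑ e, k e := by
      by_contra hne
      apply h0
      apply (G.subdivide k).fullW_isHomogeneous.coeff_eq_zero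
      simpa using hne
    have hd : d.degree ≤ n := by simpa using hd
    rw [Finset.mem_coe, Fintype.mem_piFinset]
    intro e
    have : k e ≤ ∑ e, k e := Finset.single_le_sum (fun _ _ => Nat.zero_le _) (Finset.mem_univ e)
    rw [Finset.mem_range]
    omega
  rw [h1, Finset.sum_congr rfl fun d hd => by rw [h2 d hd]]
  simp only [mul_smul]
  rw [← Finset.smul_sum]
  congr 1
  simp only [Finset.sum_smul]
  rw [Finset.sum_comm]
  refine Finset.sum_congr rfl fun k _ => ?_
  simp only [coeff_fullW, Int.cast_sum, Finset.sum_smul]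
  rw [Finset.sum_comm]
  refine Finset.sum_congr (by congr!) fun c _ => ?_
  rw [Finset.sum_eq_single (kindCount (G.subdivide k) c)]
  · rw [if_pos rfl, prod_kindCount, Int.cast_one, one_smul]
  · intro d _ hd
    simp [hd.symm]
  · intro hd
    rw [hdeg _ (by simpa using hd), smul_zero]

end Substitution

-- Both sides are compared through the finite coefficient formula, which commutes with the ring
-- homomorphism `toLaurentSeries`.
open Classical in
theorem toLaurentSeries_subst {V E : Type*} [Fintype V] [Fintype E] (G : Multigraph V E) :
    toLaurentSeries (MvPowerSeries.subst attachedSeries G.subdivisionSeries) =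
      substitutedSeries G := by
  ext1 n
  have h (κ) : PowerSeries.constantCoeff (treeSubstitution κ) = 0 := by
    rw [← toLaurentSeries_attachedSeries, ← PowerSeries.coeff_zero_eq_constantCoeff_apply,
      toLaurentSeries, PowerSeries.coeff_map, PowerSeries.coeff_zero_eq_constantCoeff_apply,
      constantCoeff_attachedSeries, map_zero]
  have hsmul (q : ℚ) (p : Polynomial ℚ) : (q • p).toLaurent = q • p.toLaurent :=
    map_smul (Polynomial.toLaurentAlg : Polynomial ℚ →ₐ[ℚ] LaurentPolynomial ℚ) q p
  rw [substitutedSeries, coeff_subst_subdivisionSeries _ _ h, toLaurentSeries,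
    PowerSeries.coeff_map, coeff_subst_subdivisionSeries _ _ constantCoeff_attachedSeries]
  rw [hsmul, map_sum]
  congr 1
  refine Finset.sum_congr rfl fun k _ => ?_
  rw [map_sum]
  refine Finset.sum_congr rfl fun c _ => ?_
  rw [← PowerSeries.coeff_map]
  change PowerSeries.coeff n (toLaurentSeries _) = _
  rw [map_prod]
  simp only [toLaurentSeries_attachedSeries]

/-! ### Products of tree series as sums over families of trees. -/

theorem coeff_prod_congr {ι R : Type*} [CommSemiring R] (s : Finset ι) (a b : ι → PowerSeries R)
    (n : ℕ) (h : ∀ i, ∀ m ≤ n, PowerSeries.coeff m (a i) = PowerSeries.coeff m (b i)) :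
    ∀ m ≤ n, PowerSeries.coeff m (∏ i ∈ s, a i) = PowerSeries.coeff m (∏ i ∈ s, b i) := by
  classical
  induction s using Finset.induction_on with
  | empty => simp
  | insert i s hi ih =>
    intro m hm
    rw [Finset.prod_insert hi, Finset.prod_insert hi, PowerSeries.coeff_mul, PowerSeries.coeff_mul]
    refine Finset.sum_congr rfl fun p hp => ?_
    have := Finset.HasAntidiagonal.mem_antidiagonal.1 hp
    rw [h i _ (by omega), ih _ (by omega)]

/-- The rooted trees with at most `n` vertices. -/
theorem rootedTree_order_le_finite (n : ℕ) : {q : RootedTreeClass | q.rep.order ≤ n}.Finite := by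
  refine ((Set.finite_Iic n).biUnion fun m _ => rootedTree_order_finite m).subset fun q hq => ?_
  simp only [Set.mem_iUnion]
  exact ⟨_, hq, rfl⟩

/-- The rooted trees with at most `n` vertices. -/
noncomputable def smallTrees (n : ℕ) : Finset RootedTreeClass :=
  (rootedTree_order_le_finite n).toFinset

theorem mem_smallTrees {n : ℕ} {q : RootedTreeClass} : q ∈ smallTrees n ↔ q.rep.order ≤ n := by
  simp [smallTrees]

/-- The weight `1 / |Aut T|` of a rooted tree. -/
noncomputable def RootedTreeClass.weight (q : RootedTreeClass) : ℚ :=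
  (q.rep.graph.rootedAutCard q.rep.root : ℚ)⁻¹

/-- The coefficients of a product of tree series are sums over families of trees. -/
theorem coeff_prod_treeSum {V : Type*} [Fintype V] [DecidableEq V]
    (F : V → RootedTree → Polynomial ℤ) (n : ℕ) :
    PowerSeries.coeff n (∏ v, treeSum (F v)) =
      ∑ f ∈ Fintype.piFinset fun _ : V => smallTrees n,
        if ∑ v, (f v).rep.order = n then
          (∏ v, (f v).weight) • (∏ v, F v (f v).rep).map (Int.castRingHom ℚ) else 0 := by
  -- Truncation to trees with at most `n` vertices leaves the coefficients up to `n` intact and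
  -- makes the product a finite expansion.
  let b (v : V) : PowerSeries (Polynomial ℚ) := ∑ q ∈ smallTrees n,
    PowerSeries.monomial q.rep.order (q.weight • (F v q.rep).map (Int.castRingHom ℚ))
  have hb (v : V) (m : ℕ) (hm : m ≤ n) :
      PowerSeries.coeff m (treeSum (F v)) = PowerSeries.coeff m (b v) := by
    rw [coeff_treeSum, map_sum]
    simp only [PowerSeries.coeff_monomial]
    rw [← Finset.sum_filter]
    refine Finset.sum_congr ?_ fun q _ => rfl
    ext q
    simp only [Set.Finite.mem_toFinset, Set.mem_ofPred_eq, Finset.mem_filter, mem_smallTrees]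
    omega
  rw [coeff_prod_congr _ _ b n hb n le_rfl, Finset.prod_univ_sum, map_sum]
  refine Finset.sum_congr (by congr!) fun f _ => ?_
  have : ∏ v, PowerSeries.monomial (f v).rep.order
      ((f v).weight • (F v (f v).rep).map (Int.castRingHom ℚ)) =
      PowerSeries.monomial (∑ v, (f v).rep.order)
        (∏ v, (f v).weight • (F v (f v).rep).map (Int.castRingHom ℚ)) :=
    PowerSeries.prod_monomial _ _ _
  rw [this, PowerSeries.coeff_monomial]
  have h2 : ∏ v, (f v).weight • (F v (f v).rep).map (Int.castRingHom ℚ) =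
      (∏ v, (f v).weight) • (∏ v, F v (f v).rep).map (Int.castRingHom ℚ) := by
    rw [Finset.prod_smul, Polynomial.map_prod]
  rw [h2]
  simp only [eq_comm]

/-- The graph obtained by attaching rooted trees to the vertices of a graph. -/
noncomputable def attachTrees {V E : Type*} (C : Multigraph V E) (f : V → RootedTreeClass) :
    Multigraph (Σ v, Fin (f v).rep.order) (E ⊕ Σ v, Fin (f v).rep.size) :=
  C.assemble (fun v => (f v).rep.graph) fun v => (f v).rep.root

/-- Expanding the product chooses a tree at each vertex; the sum over colourings of `C` is then
reassembled by `W_assemble`. -/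
theorem sum_coeff_prod_attachedSeries {V E : Type*} [Fintype V] [Fintype E] [DecidableEq V]
    [Fintype (V → ZMod 2)]
    (C : Multigraph V E) (n : ℕ) :
    ∑ c, PowerSeries.coeff n (∏ v, attachedSeries (C.kind c v)) =
      ∑ f ∈ Fintype.piFinset fun _ : V => smallTrees n,
        if ∑ v, (f v).rep.order = n then
          (∏ v, (f v).weight) • (attachTrees C f).W.map (Int.castRingHom ℚ) else 0 := by
  have h (c : V → ZMod 2) := coeff_prod_treeSum
    (fun v T => T.graph.attachedW T.root (C.kind c v)) n
  unfold attachedSeries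
  simp only [h]
  rw [Finset.sum_comm]
  refine Finset.sum_congr rfl fun f _ => ?_
  split_ifs with hf
  · rw [← Finset.smul_sum, ← Polynomial.map_sum, attachTrees, W_assemble]
  · simp

open Multigraph

/-! ### Isomorphism classes and weighted counts of isomorphisms. -/

section Classes

theorem MultigraphClass.eq_of_iso {q q' : MultigraphClass}
    (φ : Iso q.rep.graph q'.rep.graph) : q = q' := by
  have h : (Quotient.mk FinMultigraph.setoid q.rep) = Quotient.mk FinMultigraph.setoid q'.rep :=
    Quotient.sound ⟨φ⟩
  rwa [show Quotient.mk FinMultigraph.setoid q.rep = q from Quotient.out_eq q,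
    show Quotient.mk FinMultigraph.setoid q'.rep = q' from Quotient.out_eq q'] at h

theorem exists_multigraphClass {V E : Type*} [Fintype V] [Fintype E] (G : Multigraph V E) :
    ∃ q : MultigraphClass, Nonempty (Iso G q.rep.graph) := by
  let G' := G.relabel (Fintype.equivFin V) (Fintype.equivFin E)
  obtain ⟨φ⟩ : Nonempty (Iso (Quotient.mk FinMultigraph.setoid ⟨_, _, G'⟩).out.graph G') :=
    Quotient.mk_out (s := FinMultigraph.setoid) ⟨_, _, G'⟩
  exact ⟨Quotient.mk FinMultigraph.setoid ⟨_, _, G'⟩,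
    ⟨(G.relabelIso (Fintype.equivFin V) (Fintype.equivFin E)).trans φ.symm⟩⟩

theorem RootedTreeClass.eq_of_iso {q q' : RootedTreeClass}
    (φ : Iso q.rep.graph q'.rep.graph) (hφ : φ.vert q.rep.root = q'.rep.root) : q = q' := by
  have h : (Quotient.mk RootedTree.setoid q.rep) = Quotient.mk RootedTree.setoid q'.rep :=
    Quotient.sound ⟨φ, hφ⟩
  rwa [show Quotient.mk RootedTree.setoid q.rep = q from Quotient.out_eq q,
    show Quotient.mk RootedTree.setoid q'.rep = q' from Quotient.out_eq q'] at h

theorem exists_rootedTreeClass {V E : Type*} [Fintype V] [Fintype E] {T : Multigraph V E}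
    (r : V) (hT : T.Connected) (hT0 : T.loopNumber = 0) :
    ∃ q : RootedTreeClass, ∃ φ : Iso q.rep.graph T, φ.vert q.rep.root = r := by
  let ψ := T.relabelIso (Fintype.equivFin V) (Fintype.equivFin E)
  let T' : RootedTree := ⟨_, _, T.relabel (Fintype.equivFin V) (Fintype.equivFin E),
    Fintype.equivFin V r, ψ.connected hT, by rw [ψ.loopNumber_eq hT, hT0]⟩
  obtain ⟨φ, hφ⟩ : ∃ φ : Iso (Quotient.mk RootedTree.setoid T').out.graph T'.graph,
    φ.vert (Quotient.mk RootedTree.setoid T').out.root = T'.root :=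
    Quotient.mk_out (s := RootedTree.setoid) T'
  refine ⟨Quotient.mk RootedTree.setoid T', φ.trans ψ.symm, ?_⟩
  change ψ.vert.symm (φ.vert (Quotient.mk RootedTree.setoid T').out.root) = r
  rw [hφ]
  exact ψ.vert.symm_apply_apply r

theorem autCard_ne_zero {V E : Type*} [Finite V] [Finite E] (G : Multigraph V E) :
    (G.autCard : ℚ) ≠ 0 := by
  have : Nonempty (Iso G G) := ⟨Iso.refl G⟩
  exact Nat.cast_ne_zero.2 Nat.card_pos.ne'

theorem rootedAutCard_ne_zero {V E : Type*} [Finite V] [Finite E] (G : Multigraph V E) (r : V) :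
    (G.rootedAutCard r : ℚ) ≠ 0 := by
  have : Nonempty {φ : Iso G G // φ.vert r = r} := ⟨⟨Iso.refl G, rfl⟩⟩
  exact Nat.cast_ne_zero.2 Nat.card_pos.ne'

/-- Only the class `q'` itself admits isomorphisms to `q'`, and their number cancels the weight.
This replaces orbit counting for the trees. -/
theorem sum_weight_mul_card_iso {s : Finset RootedTreeClass} {q' : RootedTreeClass}
    (hq' : q' ∈ s) : ∑ q ∈ s, q.weight *
      (Nat.card {ψ : Iso q.rep.graph q'.rep.graph // ψ.vert q.rep.root = q'.rep.root} : ℚ) = 1 := by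
  rw [Finset.sum_eq_single q']
  · exact inv_mul_cancel₀ (rootedAutCard_ne_zero _ _)
  · intro q _ hq
    have : IsEmpty {ψ : Iso q.rep.graph q'.rep.graph // ψ.vert q.rep.root = q'.rep.root} :=
      ⟨fun ψ => hq (RootedTreeClass.eq_of_iso ψ.1 ψ.2)⟩
    rw [Nat.card_of_isEmpty, Nat.cast_zero, mul_zero]
  · exact fun h => absurd hq' h

theorem sum_inv_autCard_mul_card_iso {s : Finset MultigraphClass} {q' : MultigraphClass}
    (hq' : q' ∈ s) : ∑ q ∈ s, (q.rep.graph.autCard : ℚ)⁻¹ *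
      (Nat.card (Iso q.rep.graph q'.rep.graph) : ℚ) = 1 := by
  rw [Finset.sum_eq_single q']
  · exact inv_mul_cancel₀ (autCard_ne_zero _)
  · intro q _ hq
    have : IsEmpty (Iso q.rep.graph q'.rep.graph) :=
      ⟨fun ψ => hq (MultigraphClass.eq_of_iso ψ)⟩
    rw [Nat.card_of_isEmpty, Nat.cast_zero, mul_zero]
  · exact fun h => absurd hq' h

/-- Counting half-edges gives `3v ≤ 2e`, and `e = v + g - 1`, so the order is bounded in terms of
`g`. -/
theorem gammaGeThree_finite {g : ℕ} : (GammaGeThree g).Finite := by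
  refine ((Set.finite_Iic (2 * g)).biUnion fun n _ => gamma_order_finite g n).subset ?_
  rintro q ⟨hq, hdeg⟩
  simp only [Set.mem_iUnion]
  refine ⟨q.rep.order, ?_, hq, rfl⟩
  have h1 := hq.1.loopNumber_add_card
  have h2 := q.rep.graph.sum_degree
  have h3 : ∑ _v : Fin q.rep.order, 3 ≤ ∑ v, q.rep.graph.degree v :=
    Finset.sum_le_sum fun v _ => hdeg v
  rw [hq.2] at h1
  simp only [Fintype.card_fin, Finset.sum_const, Finset.card_univ, smul_eq_mul] at h1 h2 h3
  change q.rep.order ≤ 2 * g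
  omega

end Classes

/-! ### The total weight of all decompositions, and the final summation. -/

section Structure

variable {V E : Type*}

theorem attachTrees_connected {C : Multigraph V E} (hC : C.Connected)
    (f : V → RootedTreeClass) : (attachTrees C f).Connected :=
  hC.assemble _ fun v => (f v).rep.connected

theorem loopNumber_attachTrees [Fintype V] [Fintype E] {C : Multigraph V E} (hC : C.Connected)
    (f : V → RootedTreeClass) : (attachTrees C f).loopNumber = C.loopNumber :=
  loopNumber_assemble _ hC (fun v => (f v).rep.connected) fun v => (f v).rep.loopNumber_eq

theorem two_le_degree_subdivide {G : Multigraph V E} (hG : ∀ v, 3 ≤ G.degree v) (k : E → ℕ)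
    (v : V ⊕ Σ e, Fin (k e)) : 2 ≤ (G.subdivide k).degree v := by
  rcases v with v | x
  · rw [degree_subdivide_inl]
    exact (by norm_num : 2 ≤ 3).trans (hG v)
  · rw [degree_subdivide_inr]

/-- Every connected graph with loop number `g ≥ 2` is obtained from a graph with all degrees at
least `3` by subdividing the edges and then attaching trees to the vertices. -/
theorem exists_iso_attachTrees_subdivide {V E : Type} [Fintype V] [Fintype E]
    {H : Multigraph V E} {g : ℕ} (hg : 2 ≤ g) (hH : H.Connected) (hl : H.loopNumber = g) :
    ∃ q ∈ GammaGeThree g, ∃ k f, Nonempty (Iso (attachTrees (q.rep.graph.subdivide k) f) H) := by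
  obtain ⟨V₁, E₁, _, _, C, VT, ET, _, _, T, r, hC, hCl, hCdeg, hT, hT0, ⟨Φ⟩⟩ :=
    exists_iso_assemble hH (by omega)
  obtain ⟨V₀, E₀, _, _, G, k₀, hG, ⟨φ⟩⟩ := exists_iso_subdivide C hC (by omega) hCdeg
  have hGc : G.Connected := (G.subdivide_connected_iff k₀).1 (φ.connected hC)
  have hGl : G.loopNumber = g := by
    rw [← subdivide_loopNumber hGc k₀, φ.loopNumber_eq hC, hCl, hl]
  obtain ⟨q, ⟨ψ⟩⟩ := exists_multigraphClass G
  have hq : q ∈ GammaGeThree g := by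
    refine ⟨⟨ψ.connected hGc, by rw [ψ.loopNumber_eq hGc, hGl]⟩, fun v => ?_⟩
    rw [← ψ.symm.degree_eq]
    exact hG _
  choose t χ hχ using fun v => exists_rootedTreeClass (r v) (hT v) (hT0 v)
  let θ : Iso (q.rep.graph.subdivide (ψ.symm.pullback k₀)) C :=
    (ψ.symm.subdivide k₀ _ rfl (attach_surjective_of_degree fun v => by
      have := hq.2 v
      omega)).trans φ.symm
  refine ⟨q, hq, ψ.symm.pullback k₀, fun w => t (θ.vert w), ⟨Iso.trans ?_ Φ.symm⟩⟩
  exact θ.assemble (fun w => χ (θ.vert w)) fun w => hχ (θ.vert w)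

end Structure

open Classical in
/-- The total weight of the isomorphisms between a connected graph with loop number `g` and the
graphs obtained by subdividing edges and attaching trees. -/
theorem sum_weight_card_iso {g n : ℕ} (hg : 2 ≤ g) {H : MultigraphClass} (hH : H ∈ Gamma g)
    (hn : H.rep.order = n) :
    ∑ q ∈ (gammaGeThree_finite (g := g)).toFinset, (q.rep.graph.autCard : ℚ)⁻¹ *
      ∑ k ∈ Fintype.piFinset fun _ : Fin q.rep.size => Finset.range (n + 1),
        ∑ f ∈ Fintype.piFinset fun _ : _ ⊕ Σ e, Fin (k e) => smallTrees n,
          (∏ v, (f v).weight) *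
            (Nat.card (Iso (attachTrees (q.rep.graph.subdivide k) f) H.rep.graph) : ℚ) = 1 := by
  obtain ⟨q₀, hq₀, k₀, f₀, ⟨Φ⟩⟩ := exists_iso_attachTrees_subdivide hg hH.1 hH.2
  have hcard : ∑ v, (f₀ v).rep.order = n := by
    have := Φ.card_vert_eq
    simpa only [Fintype.card_sigma, Fintype.card_fin, hn] using this
  have hf₀ (v) : f₀ v ∈ smallTrees n := by
    rw [mem_smallTrees, ← hcard]
    exact Finset.single_le_sum (f := fun v => (f₀ v).rep.order) (fun _ _ => Nat.zero_le _)
      (Finset.mem_univ v)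
  have hk₀ (e) : k₀ e < n + 1 := by
    have h1 : ∑ _v : Fin q₀.rep.order ⊕ Σ e, Fin (k₀ e), 1 ≤ ∑ v, (f₀ v).rep.order :=
      Finset.sum_le_sum fun v _ => (f₀ v).rep.root.pos
    have h2 : k₀ e ≤ ∑ e, k₀ e :=
      Finset.single_le_sum (fun _ _ => Nat.zero_le _) (Finset.mem_univ e)
    simp only [Finset.sum_const, Finset.card_univ, smul_eq_mul, mul_one, Fintype.card_sum,
      Fintype.card_sigma, Fintype.card_fin] at h1
    omega
  -- The 1 on the right is expanded as a sum over the same classes, so that it suffices to compare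
  -- the two sides for each `q`.
  rw [← sum_inv_autCard_mul_card_iso ((Set.Finite.mem_toFinset _).2 hq₀ :
    q₀ ∈ (gammaGeThree_finite (g := g)).toFinset)]
  refine Finset.sum_congr rfl fun q hq => ?_
  rw [Set.Finite.mem_toFinset] at hq
  congr 1
  rw [← sum_card_iso_subdivide q.rep.graph q₀.rep.graph hq.2 hq₀.2 k₀
    (Fintype.piFinset fun _ => Finset.range (n + 1)) (fun ψ => by
      rw [Fintype.mem_piFinset]
      exact fun e => Finset.mem_range.2 (hk₀ _)), Nat.cast_sum]
  refine Finset.sum_congr (by congr!) fun k _ => ?_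
  have := Fintype.ofFinite (Iso (q.rep.graph.subdivide k) (q₀.rep.graph.subdivide k₀))
  have h1 (f) : Nat.card (Iso (attachTrees (q.rep.graph.subdivide k) f) H.rep.graph) =
      ∑ φ : Iso (q.rep.graph.subdivide k) (q₀.rep.graph.subdivide k₀), ∏ v,
        Nat.card {ψ : Iso (f v).rep.graph (f₀ (φ.vert v)).rep.graph //
          ψ.vert (f v).rep.root = (f₀ (φ.vert v)).rep.root} := by
    rw [← Nat.card_congr Φ.congrRight]
    exact card_iso_assemble (two_le_degree_subdivide hq.2 k) (two_le_degree_subdivide hq₀.2 k₀)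
      (fun v => (f v).rep.connected) (fun v => (f₀ v).rep.connected)
      (fun v => (f v).rep.loopNumber_eq) fun v => (f₀ v).rep.loopNumber_eq
  simp only [h1, Nat.cast_sum, Nat.cast_prod, Finset.mul_sum, ← Finset.prod_mul_distrib]
  rw [Finset.sum_comm]
  -- For a fixed `φ` the sum over tree families factors over the vertices, and every factor is 1.
  have h2 (φ : Iso (q.rep.graph.subdivide k) (q₀.rep.graph.subdivide k₀)) :
      ∑ f ∈ Fintype.piFinset fun _ : _ ⊕ Σ e, Fin (k e) => smallTrees n, ∏ v, (f v).weight *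
        (Nat.card {ψ : Iso (f v).rep.graph (f₀ (φ.vert v)).rep.graph //
          ψ.vert (f v).rep.root = (f₀ (φ.vert v)).rep.root} : ℚ) = 1 := by
    have := Finset.prod_univ_sum (fun _ : Fin q.rep.order ⊕ Σ e, Fin (k e) => smallTrees n)
      fun v t => t.weight * (Nat.card {ψ : Iso t.rep.graph (f₀ (φ.vert v)).rep.graph //
          ψ.vert t.rep.root = (f₀ (φ.vert v)).rep.root} : ℚ)
    refine Eq.trans ?_ (this.symm.trans (Finset.prod_eq_one fun v _ =>
      sum_weight_mul_card_iso (hf₀ _)))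
    congr!
  rw [Finset.sum_congr rfl fun φ _ => h2 φ]
  simp

/-- Summation over the isomorphism class of a graph. -/
theorem sum_card_iso_smul {V E : Type*} [Fintype V] [Fintype E] {A : Multigraph V E} {g : ℕ}
    (hA : A.Connected) (hl : A.loopNumber = g) (n : ℕ) :
    ∑ H ∈ (gamma_order_finite g n).toFinset, (Nat.card (Iso A H.rep.graph) : ℚ) •
      ((H.rep.graph.autCard : ℚ)⁻¹ • H.rep.graph.W.map (Int.castRingHom ℚ)) =
      if Fintype.card V = n then A.W.map (Int.castRingHom ℚ) else 0 := by
  obtain ⟨q, ⟨φ⟩⟩ := exists_multigraphClass A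
  have hq : q ∈ Gamma g := ⟨φ.connected hA, by rw [φ.loopNumber_eq hA, hl]⟩
  have hord : Fintype.card V = q.rep.order := by
    rw [φ.card_vert_eq, Fintype.card_fin]
  have hzero (H : MultigraphClass) (hH : H ≠ q) : (Nat.card (Iso A H.rep.graph) : ℚ) = 0 := by
    have : IsEmpty (Iso A H.rep.graph) :=
      ⟨fun ψ => hH (MultigraphClass.eq_of_iso (ψ.symm.trans φ))⟩
    rw [Nat.card_of_isEmpty, Nat.cast_zero]
  split_ifs with hn
  · rw [Finset.sum_eq_single q]
    · have : Nat.card (Iso A q.rep.graph) = q.rep.graph.autCard :=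
        Nat.card_congr
          { toFun := fun ψ => φ.symm.trans ψ
            invFun := fun ψ => φ.trans ψ
            left_inv := fun ψ => by ext <;> simp [Iso.trans, Iso.symm]
            right_inv := fun ψ => by ext <;> simp [Iso.trans, Iso.symm] }
      rw [this, smul_smul, mul_inv_cancel₀ (autCard_ne_zero _), one_smul, φ.W_eq]
    · intro H _ hH
      rw [hzero H hH, zero_smul]
    · intro h
      exact absurd ((gamma_order_finite g n).mem_toFinset.2 ⟨hq, hord.symm.trans hn⟩) h
  · refine Finset.sum_eq_zero fun H hH => ?_
    rw [hzero H, zero_smul]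
    rintro rfl
    exact hn (hord.trans ((gamma_order_finite g n).mem_toFinset.1 hH).2)

theorem wrightSeries_eq {g : ℕ} (hg : 2 ≤ g) : wrightSeries g =
    ∑ q ∈ (gammaGeThree_finite (g := g)).toFinset,
      MvPowerSeries.subst attachedSeries q.rep.graph.subdivisionSeries := by
  classical
  ext1 n
  rw [map_sum]
  have h1 (q : MultigraphClass) := coeff_subst_subdivisionSeries q.rep.graph attachedSeries
    constantCoeff_attachedSeries n
  simp only [h1, sum_coeff_prod_attachedSeries]
  rw [wrightSeries, PowerSeries.coeff_mk,
    finsum_mem_eq_finite_toFinset_sum _ (gamma_order_finite g n)]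
  -- Each graph `H` is multiplied by the total weight 1 of its decompositions. With the sums
  -- exchanged, the sum over `H` retains only the class of the assembled graph, where the number of
  -- isomorphisms cancels `|Aut H|`.
  have h2 : ∀ H ∈ (gamma_order_finite g n).toFinset,
      (H.rep.graph.autCard : ℚ)⁻¹ • H.rep.graph.W.map (Int.castRingHom ℚ) =
      (∑ q ∈ (gammaGeThree_finite (g := g)).toFinset, (q.rep.graph.autCard : ℚ)⁻¹ *
      ∑ k ∈ Fintype.piFinset fun _ : Fin q.rep.size => Finset.range (n + 1),
        ∑ f ∈ Fintype.piFinset fun _ : _ ⊕ Σ e, Fin (k e) => smallTrees n,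
          (∏ v, (f v).weight) *
            (Nat.card (Iso (attachTrees (q.rep.graph.subdivide k) f) H.rep.graph) : ℚ)) •
      ((H.rep.graph.autCard : ℚ)⁻¹ • H.rep.graph.W.map (Int.castRingHom ℚ)) := by
    intro H hH
    rw [Set.Finite.mem_toFinset] at hH
    rw [sum_weight_card_iso hg hH.1 hH.2, one_smul]
  rw [Finset.sum_congr rfl h2]
  simp only [Finset.sum_smul, mul_smul, Finset.smul_sum]
  rw [Finset.sum_comm]
  refine Finset.sum_congr rfl fun q hq => ?_
  rw [Set.Finite.mem_toFinset] at hq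
  rw [Finset.sum_comm]
  refine Finset.sum_congr (by congr!) fun k _ => ?_
  rw [Finset.sum_comm]
  refine Finset.sum_congr (by congr!) fun f _ => ?_
  have hc := (q.rep.graph.subdivide_connected_iff k).2 hq.1.1
  have h4 := sum_card_iso_smul (attachTrees_connected hc f)
    ((loopNumber_attachTrees hc f).trans ((subdivide_loopNumber hq.1.1 k).trans hq.1.2)) n
  simp only [Fintype.card_sigma, Fintype.card_fin] at h4
  rw [← Finset.smul_sum, ← Finset.smul_sum, h4]
  split_ifs <;> simp

end BlackWhite

theorem theorem4p5 (g : ℕ) (hg : 2 ≤ g) :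
    (BlackWhite.GammaGeThree g).Finite ∧
    ∃ 𝒳 : BlackWhite.MultigraphClass → PowerSeries (Polynomial ℚ),
      (∀ G ∈ BlackWhite.GammaGeThree g,
        BlackWhite.toLaurentSeries (𝒳 G) = BlackWhite.substitutedSeries G.rep.graph) ∧
      BlackWhite.wrightSeries g = ∑ᶠ G ∈ BlackWhite.GammaGeThree g, 𝒳 G := by
  refine ⟨BlackWhite.gammaGeThree_finite, fun G => MvPowerSeries.subst BlackWhite.attachedSeries
    G.rep.graph.subdivisionSeries, fun G _ => BlackWhite.toLaurentSeries_subst _, ?_⟩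
  rw [BlackWhite.wrightSeries_eq hg,
    finsum_mem_eq_finite_toFinset_sum _ BlackWhite.gammaGeThree_finite]
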